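/- A polytope is the convex hull of finitely many points; a $d$-polytope is one whose affine hull has dimension $d$; it is simplicial if all its proper faces are simplices; and its graph has its vertices and its one-dimensional faces as vertices and edges. An edge cut of a graph with vertex set $V$ is the set of edges with one endpoint in $X$ and the other in $\overline X$, for some partition $V = X \sqcup \overline X$ into two nonempty parts. It is minimum if no edge cut of the graph has fewer edges, and trivial if it is the set of all edges incident to some vertex. For each $d \ge 4$, there is a simplicial $d$-polytope whose graph has minimum degree at least $d(d+1)/2$ and has a nontrivial minimum edge cut with exactly $d(d+1)/2$ edges. -/

import Mathlib

namespace PolytopeGraph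

section Polytopes

variable {E : Type*} [NormedAddCommGroup E] [InnerProductSpace ℝ E]

/-- A polytope is the convex hull of finitely many points. -/
def IsPolytope (P : Set E) : Prop :=
  ∃ s : Finset E, P = convexHull ℝ (s : Set E)

/-- The dimension of the affine hull of a (nonempty) set. -/
noncomputable def dim (P : Set E) : ℕ :=
  Module.finrank ℝ (affineSpan ℝ P).direction

/-- A nonempty face of `P`: the nonempty set of maximizers on `P` of a continuous linear functional,
that is, the intersection of `P` with a supporting hyperplane (or `P` itself, when the functional is
constant on `P`). -/
def IsFace (P F : Set E) : Prop :=
  F.Nonempty ∧ IsExposed ℝ P F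

/-- The convex hull of a finite affinely independent family. -/
def IsSimplex (F : Set E) : Prop :=
  ∃ (n : ℕ) (s : Affine.Simplex ℝ E n), F = convexHull ℝ (Set.range s.points)

/-- All proper faces are simplices. -/
def IsSimplicial (P : Set E) : Prop :=
  ∀ F : Set E, IsFace P F → F ≠ P → IsSimplex F

/-- The vertices of `P`: the points `v` such that `{v}` is a (zero-dimensional) face. -/
abbrev Vertex (P : Set E) : Type _ :=
  {v : E // IsFace P {v}}

/-- The graph of a polytope: two distinct vertices are adjacent if they are the two endpoints of a
one-dimensional face, that is, if the segment joining them is a face. -/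
def graph (P : Set E) : SimpleGraph (Vertex P) where
  Adj u v := u ≠ v ∧ IsFace P (segment ℝ (u : E) (v : E))
  symm := ⟨fun u v h => ⟨h.1.symm, by rw [segment_symm]; exact h.2⟩⟩
  loopless := ⟨fun _ h => h.1 rfl⟩

end Polytopes

section EdgeCuts

variable {V : Type*} (G : SimpleGraph V)

/-- The set of edges with one endpoint in `X` and the other one outside `X`. -/
def cutEdges (X : Set V) : Set (Sym2 V) :=
  {e | e ∈ G.edgeSet ∧ ∃ u ∈ X, ∃ v ∈ Xᶜ, e = s(u, v)}

/-- An edge cut: the edges between the two parts of a partition of the vertices into two nonempty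
parts. -/
def IsEdgeCut (C : Set (Sym2 V)) : Prop :=
  ∃ X : Set V, X.Nonempty ∧ Xᶜ.Nonempty ∧ C = cutEdges G X

/-- An edge cut of smallest cardinality among all edge cuts. -/
def IsMinimumEdgeCut (C : Set (Sym2 V)) : Prop :=
  IsEdgeCut G C ∧ ∀ C' : Set (Sym2 V), IsEdgeCut G C' → C.encard ≤ C'.encard

/-- An edge set is trivial if it consists of all the edges incident to some vertex. -/
def IsTrivialCut (C : Set (Sym2 V)) : Prop :=
  ∃ v : V, C = G.incidenceSet v

end EdgeCuts

end PolytopeGraph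

/-! Two large cliques are joined through a sparse middle. Take two (d-1)-simplices with vertices A_k
and B_k that span a prism, and tilt them by small increasing amounts t_k. The tilts decide which
diagonal of each quadrilateral A_i A_j B_j B_i becomes an edge: A_i B_j is an edge exactly when i ≤
j, which gives D = d(d+1)/2 middle edges. Beyond each simplex put a cluster of D+1 vertices on a
curve that behaves like a moment curve of degree four. The cluster is then a clique, completely
joined to its simplex, because the polynomials (r-s)²(r-s')² come from positive weights on four
coordinates; this is where d ≥ 4 enters. No further edges run between the two halves.

All degrees are at least D. A cut that splits a cluster has at least D edges, one that separates a
simplex vertex from its unsplit cluster has at least D+1, and the only remaining cut is the middle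
one (`exists_nontrivial_minimumEdgeCut`).

Everything geometric is linear algebra in homogeneous coordinates: a functional certifies an edge
(`ExposesPair`), a linear dependence certifies a non-edge (`ObstructsPair`). Both certificates
survive small perturbations, and a generic perturbation makes the polytope simplicial
(`exists_simplicial_polytope`). -/

namespace PolytopeGraph

open Set Filter Topology

/-! ### Faces of the convex hull of a family of points. -/

section Faces

variable {E : Type*} [NormedAddCommGroup E] [InnerProductSpace ℝ E] {I : Type*}

lemma le_of_mem_convexHull_range {p : I → E} {l : E →L[ℝ] ℝ} {M : ℝ} (hM : ∀ i, l (p i) ≤ M)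
    {x : E} (hx : x ∈ convexHull ℝ (range p)) : l x ≤ M := by
  have : convexHull ℝ (range p) ⊆ {y | l y ≤ M} :=
    convexHull_min (by rintro _ ⟨i, rfl⟩; exact hM i)
      (convex_halfSpace_le l.toLinearMap.isLinear M)
  exact this hx

/-- The points of a convex hull where a functional attains its maximum are the convex hull of the
generators where it does. -/
lemma maximizers_convexHull_range {p : I → E} {l : E →L[ℝ] ℝ} {M : ℝ}
    (hM : ∀ i, l (p i) ≤ M) (hne : ∃ i, l (p i) = M) :
    {x ∈ convexHull ℝ (range p) | ∀ y ∈ convexHull ℝ (range p), l y ≤ l x} =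
      convexHull ℝ (p '' {i | l (p i) = M}) := by
  obtain ⟨i₀, hi₀⟩ := hne
  apply Subset.antisymm
  · rintro x ⟨hx, hmax⟩
    have hxM : l x = M := le_antisymm (le_of_mem_convexHull_range hM hx)
      (hi₀ ▸ hmax _ (subset_convexHull ℝ _ ⟨i₀, rfl⟩))
    rw [mem_convexHull_iff_exists_fintype] at hx
    obtain ⟨ι, _, w, z, hw, hw1, hz, hzx⟩ := hx
    -- The deficits `M - l (z i)` are nonnegative with weighted sum zero, so only maximizing
    -- generators carry weight.
    have hsum : ∑ i, w i * (M - l (z i)) = 0 := by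
      have h1 : ∑ i, w i * l (z i) = M := by
        rw [← hxM, ← hzx, map_sum]; simp
      simp only [mul_sub, Finset.sum_sub_distrib, ← Finset.sum_mul, hw1, h1]; ring
    have hzM : ∀ i, l (z i) ≤ M := fun i => by
      obtain ⟨k, hk⟩ := hz i
      rw [← hk]; exact hM k
    have hzero := (Finset.sum_eq_zero_iff_of_nonneg
      (fun i _ => mul_nonneg (hw i) (sub_nonneg.2 (hzM i)))).1 hsum
    rw [← hzx]
    have hs : ∑ i, w i • z i = ∑ i with w i ≠ 0, w i • z i := by
      rw [Finset.sum_filter]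
      refine Finset.sum_congr rfl fun i _ => ?_
      by_cases h : w i = 0 <;> simp [h]
    have hs1 : ∑ i with w i ≠ 0, w i = 1 := by
      rw [← hw1, Finset.sum_filter]
      refine Finset.sum_congr rfl fun i _ => ?_
      by_cases h : w i = 0 <;> simp [h]
    rw [hs]
    refine (convex_convexHull ℝ _).sum_mem (fun i _ => hw i) hs1 fun i hi => ?_
    obtain ⟨k, hk⟩ := hz i
    refine subset_convexHull ℝ _ ⟨k, ?_, hk⟩
    have hwi : w i ≠ 0 := (Finset.mem_filter.1 hi).2
    have := (mul_eq_zero.1 (hzero i (Finset.mem_univ i))).resolve_left hwi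
    rw [mem_ofPred_eq, hk]; linarith
  · intro x hx
    have hxP : x ∈ convexHull ℝ (range p) := convexHull_mono (image_subset_range _ _) hx
    refine ⟨hxP, fun y hy => ?_⟩
    have hxM : M ≤ l x := by
      have : convexHull ℝ (p '' {i | l (p i) = M}) ⊆ {y | M ≤ l y} :=
        convexHull_min (by rintro _ ⟨i, hi, rfl⟩; exact hi.ge)
          (convex_halfSpace_ge l.toLinearMap.isLinear M)
      exact this hx
    exact (le_of_mem_convexHull_range hM hy).trans hxM

lemma isFace_convexHull_image {p : I → E} {l : E →L[ℝ] ℝ} {M : ℝ}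
    (hM : ∀ i, l (p i) ≤ M) (hne : ∃ i, l (p i) = M) :
    IsFace (convexHull ℝ (range p)) (convexHull ℝ (p '' {i | l (p i) = M})) := by
  obtain ⟨i, hi⟩ := hne
  exact ⟨⟨p i, subset_convexHull ℝ _ ⟨i, hi, rfl⟩⟩,
    fun _ => ⟨l, (maximizers_convexHull_range hM ⟨i, hi⟩).symm⟩⟩

lemma IsFace.exists_functional [Finite I] {p : I → E} {F : Set E} (hF : IsFace (convexHull ℝ (range p)) F) :
    ∃ (l : E →L[ℝ] ℝ) (M : ℝ), (∀ i, l (p i) ≤ M) ∧ (∃ i, l (p i) = M) ∧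
      F = {x ∈ convexHull ℝ (range p) | ∀ y ∈ convexHull ℝ (range p), l y ≤ l x} ∧
      F = convexHull ℝ (p '' {i | l (p i) = M}) := by
  obtain ⟨hne, hex⟩ := hF
  obtain ⟨l, hl⟩ := hex hne
  have : Nonempty I := by
    obtain ⟨x, hx⟩ := hne
    rw [hl] at hx
    have := convexHull_nonempty_iff.1 ⟨x, hx.1⟩
    exact range_nonempty_iff_nonempty.1 this
  obtain ⟨i, hi⟩ := Finite.exists_max (fun i => l (p i))
  exact ⟨l, l (p i), hi, ⟨i, rfl⟩, hl, hl.trans (maximizers_convexHull_range hi ⟨i, rfl⟩)⟩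

end Faces

/-! ### Polytopes from vector configurations. -/

section Homogeneous

variable {d : ℕ}

/-- The point with homogeneous coordinates `x`, where `x 0` is the homogenizing coordinate. -/
noncomputable def dehomogenize (x : Fin (d + 1) → ℝ) : EuclideanSpace ℝ (Fin d) :=
  WithLp.toLp 2 fun k => x k.succ / x 0

/-- The embedding of the directions of affine space as the hyperplane at infinity. -/
noncomputable def atInfinity : EuclideanSpace ℝ (Fin d) →ₗ[ℝ] (Fin (d + 1) → ℝ) where
  toFun y := Fin.cons 0 fun k => y k
  map_add' x y := by ext i; refine Fin.cases ?_ (fun k => ?_) i <;> simp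
  map_smul' c x := by ext i; refine Fin.cases ?_ (fun k => ?_) i <;> simp

lemma atInfinity_dehomogenize {x : Fin (d + 1) → ℝ} (hx : x 0 ≠ 0) :
    atInfinity (dehomogenize x) = (x 0)⁻¹ • x - Pi.single 0 1 := by
  ext i
  refine Fin.cases ?_ (fun k => ?_) i
  · simp [atInfinity, hx]
  · simp [atInfinity, dehomogenize, div_eq_inv_mul]

/-- A linear functional on homogeneous coordinates as a functional on affine space, up to a constant
and a sign. -/
lemma exists_affine_functional (φ : (Fin (d + 1) → ℝ) →ₗ[ℝ] ℝ) :
    ∃ l : EuclideanSpace ℝ (Fin d) →L[ℝ] ℝ, ∀ x : Fin (d + 1) → ℝ, x 0 ≠ 0 →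
      l (dehomogenize x) = φ (Pi.single 0 1) - (x 0)⁻¹ * φ x := by
  refine ⟨LinearMap.toContinuousLinearMap (-(φ ∘ₗ atInfinity)), fun x hx => ?_⟩
  simp only [LinearMap.coe_toContinuousLinearMap', LinearMap.neg_apply, LinearMap.comp_apply,
    atInfinity_dehomogenize hx, map_sub, map_smul, smul_eq_mul]
  ring

lemma exists_homogeneous_functional (l : EuclideanSpace ℝ (Fin d) →L[ℝ] ℝ) (M : ℝ) :
    ∃ φ : (Fin (d + 1) → ℝ) →ₗ[ℝ] ℝ, ∀ x : Fin (d + 1) → ℝ, x 0 ≠ 0 →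
      φ x = x 0 * (M - l (dehomogenize x)) := by
  refine ⟨M • LinearMap.proj 0 - l.toLinearMap ∘ₗ
    (WithLp.linearEquiv 2 ℝ (Fin d → ℝ)).symm.toLinearMap ∘ₗ LinearMap.funLeft ℝ ℝ Fin.succ,
    fun x hx => ?_⟩
  have : (WithLp.linearEquiv 2 ℝ (Fin d → ℝ)).symm (LinearMap.funLeft ℝ ℝ Fin.succ x) =
      x 0 • dehomogenize x := by
    ext k
    simp [dehomogenize, LinearMap.funLeft, mul_div_cancel₀, hx]
  simp only [LinearMap.sub_apply, LinearMap.smul_apply, LinearMap.proj_apply, LinearMap.comp_apply,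
    LinearEquiv.coe_coe, this, ContinuousLinearMap.coe_coe, map_smul, smul_eq_mul]
  ring

/-- A functional vanishing at the vectors `v p` and `v q` and positive at all the others. -/
def ExposesPair {I : Type*} (v : I → Fin (d + 1) → ℝ) (p q : I) : Prop :=
  ∃ φ : (Fin (d + 1) → ℝ) →ₗ[ℝ] ℝ, φ (v p) = 0 ∧ φ (v q) = 0 ∧ ∀ k, k ≠ p → k ≠ q → 0 < φ (v k)

/-- A linear dependence which shows that no functional that is nonnegative on all the vectors `v k`
vanishes at `v p` and `v q` only. -/
def ObstructsPair {I : Type*} [Fintype I] (v : I → Fin (d + 1) → ℝ) (B : Set I) (p q : I) : Prop :=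
  ∃ e : I → ℝ, ∑ k, e k • v k = 0 ∧ (∀ k, k ≠ p → k ≠ q → 0 ≤ e k) ∧
    ∀ k ∈ B, k ≠ p → k ≠ q → 0 < e k

variable {I : Type*} {v : I → Fin (d + 1) → ℝ}

/-- All generators other than `k` lie in an open half-space with `k` on its boundary, and open
half-spaces are convex. -/
lemma notMem_segment (hw : ∀ i, 0 < v i 0) {p q k : I} (h : ExposesPair v k k) (hp : k ≠ p)
    (hq : k ≠ q) :
    dehomogenize (v k) ∉ segment ℝ (dehomogenize (v p)) (dehomogenize (v q)) := by
  obtain ⟨φ, hφ, -, hpos⟩ := h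
  obtain ⟨l, hl⟩ := exists_affine_functional φ
  have hl' := fun i => hl (v i) (hw i).ne'
  have h1 : ∀ i, i ≠ k → l (dehomogenize (v i)) < φ (Pi.single 0 1) := fun i hi => by
    rw [hl']
    have := mul_pos (inv_pos.2 (hw i)) (hpos i hi hi)
    linarith
  intro hmem
  have hsub := (convex_halfSpace_lt l.toLinearMap.isLinear (φ (Pi.single 0 1))).segment_subset
    (h1 p hp.symm) (h1 q hq.symm)
  have := hsub hmem
  simp [hl', hφ] at this

lemma dehomogenize_injective (hw : ∀ i, 0 < v i 0) (h : ∀ p, ExposesPair v p p) :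
    Function.Injective fun i => dehomogenize (v i) := by
  intro i j hij
  by_contra hne
  refine notMem_segment hw (h i) hne hne ?_
  simp only at hij
  rw [hij, segment_same]; rfl

/-- Since affine weights sum to zero, the homogenizing basis vector cancels, and an affine
dependence becomes a linear one with each weight divided by the positive coordinate `v (f i) 0`. -/
lemma affineIndependent_dehomogenize (hw : ∀ i, 0 < v i 0) {ι : Type*} {f : ι → I}
    (hf : LinearIndependent ℝ (v ∘ f)) :
    AffineIndependent ℝ fun i => dehomogenize (v (f i)) := by
  rw [affineIndependent_iff]
  intro s c hc hsum i hi
  have h1 := congrArg atInfinity hsum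
  simp only [map_sum, map_smul, map_zero, atInfinity_dehomogenize (hw _).ne', smul_sub,
    Finset.sum_sub_distrib, ← Finset.sum_smul, hc, zero_smul, sub_zero, smul_smul] at h1
  have h2 := linearIndependent_iff'.1 hf s (fun i => c i * (v (f i) 0)⁻¹) h1 i hi
  exact (mul_eq_zero.1 h2).resolve_right (inv_ne_zero (hw _).ne')

lemma dim_convexHull_dehomogenize (hw : ∀ i, 0 < v i 0) {f : Fin (d + 1) → I}
    (hf : LinearIndependent ℝ (v ∘ f)) :
    dim (convexHull ℝ (range fun i => dehomogenize (v i))) = d := by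
  have htop := (affineIndependent_dehomogenize hw hf).affineSpan_eq_top_iff_card_eq_finrank_add_one.2
    (by simp)
  have : affineSpan ℝ (convexHull ℝ (range fun i => dehomogenize (v i))) = ⊤ := by
    rw [affineSpan_convexHull, eq_top_iff, ← htop]
    apply affineSpan_mono
    rintro _ ⟨i, rfl⟩
    exact ⟨f i, rfl⟩
  rw [dim, this, AffineSubspace.direction_top, finrank_top, finrank_euclideanSpace_fin]

/-- A vertex lying on two exposed pairs is exposed. -/
lemma ExposesPair.vertex {p q r : I} (hqr : q ≠ r) (hq : ExposesPair v p q)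
    (hr : ExposesPair v p r) : ExposesPair v p p := by
  obtain ⟨φ, hφp, hφq, hφ⟩ := hq
  obtain ⟨ψ, hψp, hψr, hψ⟩ := hr
  refine ⟨φ + ψ, by simp [hφp, hψp], by simp [hφp, hψp], fun k hk _ => ?_⟩
  rw [LinearMap.add_apply]
  by_cases hkq : k = q
  · subst hkq
    rw [hφq, zero_add]; exact hψ k hk hqr
  by_cases hkr : k = r
  · subst hkr
    rw [hψr, add_zero]; exact hφ k hk hkq
  · exact add_pos (hφ k hk hkq) (hψ k hk hkr)

lemma ExposesPair.isFace (hw : ∀ i, 0 < v i 0) {p q : I} (h : ExposesPair v p q) :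
    IsFace (convexHull ℝ (range fun i => dehomogenize (v i)))
      (segment ℝ (dehomogenize (v p)) (dehomogenize (v q))) := by
  obtain ⟨φ, hp, hq, hk⟩ := h
  obtain ⟨l, hl⟩ := exists_affine_functional φ
  have hl' := fun i => hl (v i) (hw i).ne'
  have hnn : ∀ i, 0 ≤ φ (v i) := fun i => by
    by_cases hip : i = p
    · rw [hip, hp]
    by_cases hiq : i = q
    · rw [hiq, hq]
    exact (hk i hip hiq).le
  have hM : ∀ i, l (dehomogenize (v i)) ≤ φ (Pi.single 0 1) := fun i => by
    rw [hl']
    have := mul_nonneg (inv_pos.2 (hw i)).le (hnn i)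
    linarith
  have hJ : {i | l (dehomogenize (v i)) = φ (Pi.single 0 1)} = {p, q} := by
    ext i
    simp only [mem_ofPred_eq, hl', sub_eq_self, mul_eq_zero, inv_eq_zero, (hw i).ne', false_or,
      mem_insert_iff, mem_singleton_iff]
    constructor
    · intro h0
      by_contra hcon
      push Not at hcon
      exact (hk i hcon.1 hcon.2).ne' h0
    · rintro (rfl | rfl) <;> assumption
  have := isFace_convexHull_image hM ⟨p, by simp [hl', hp]⟩
  rwa [hJ, image_pair, convexHull_pair] at this

lemma ExposesPair.isFace_singleton (hw : ∀ i, 0 < v i 0) {p : I} (h : ExposesPair v p p) :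
    IsFace (convexHull ℝ (range fun i => dehomogenize (v i))) {dehomogenize (v p)} := by
  simpa using h.isFace hw

variable [Fintype I]

/-- A functional supporting the segment turns the dependence into a vanishing sum of nonnegative
terms. It therefore vanishes at some `k ∈ B` other than `p` and `q`, which puts a third vertex on
the segment. -/
lemma ObstructsPair.not_isFace (hw : ∀ i, 0 < v i 0) (hv : ∀ p, ExposesPair v p p) {B : Set I}
    {p q : I} (hB : ∃ k ∈ B, k ≠ p ∧ k ≠ q) (h : ObstructsPair v B p q) :
    ¬ IsFace (convexHull ℝ (range fun i => dehomogenize (v i)))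
      (segment ℝ (dehomogenize (v p)) (dehomogenize (v q))) := by
  intro hF
  obtain ⟨l, M, hM, ⟨i₀, hi₀⟩, hmax, -⟩ := hF.exists_functional
  obtain ⟨e, he, hnn, hpos⟩ := h
  obtain ⟨φ, hφ⟩ := exists_homogeneous_functional l M
  have hφ' := fun i => hφ (v i) (hw i).ne'
  have hmem : ∀ i, l (dehomogenize (v i)) = M ↔
      dehomogenize (v i) ∈ segment ℝ (dehomogenize (v p)) (dehomogenize (v q)) := fun i => by
    rw [hmax]
    constructor
    · intro h
      exact ⟨subset_convexHull ℝ _ ⟨i, rfl⟩, fun y hy => h ▸ le_of_mem_convexHull_range hM hy⟩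
    · rintro ⟨-, h⟩
      exact le_antisymm (hM i) (hi₀ ▸ h _ (subset_convexHull ℝ _ ⟨i₀, rfl⟩))
  have hp : φ (v p) = 0 := by rw [hφ', (hmem p).2 (left_mem_segment ..)]; ring
  have hq : φ (v q) = 0 := by rw [hφ', (hmem q).2 (right_mem_segment ..)]; ring
  have hφnn : ∀ i, 0 ≤ φ (v i) := fun i => by
    rw [hφ']; exact mul_nonneg (hw i).le (sub_nonneg.2 (hM i))
  have hsum : ∑ k, e k * φ (v k) = 0 := by
    have := congrArg φ he
    simpa using this
  have hterm : ∀ k ∈ Finset.univ, 0 ≤ e k * φ (v k) := fun k _ => by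
    by_cases hkp : k = p
    · rw [hkp, hp, mul_zero]
    by_cases hkq : k = q
    · rw [hkq, hq, mul_zero]
    exact mul_nonneg (hnn k hkp hkq) (hφnn k)
  obtain ⟨k, hkB, hkp, hkq⟩ := hB
  have h0 := (Finset.sum_eq_zero_iff_of_nonneg hterm).1 hsum k (Finset.mem_univ k)
  have h0' : φ (v k) = 0 := (mul_eq_zero.1 h0).resolve_left (hpos k hkB hkp hkq).ne'
  rw [hφ'] at h0'
  have hkM : l (dehomogenize (v k)) = M := by
    have := (mul_eq_zero.1 h0').resolve_left (hw k).ne'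
    linarith
  exact notMem_segment hw (hv k) hkp hkq ((hmem k).1 hkM)

lemma isSimplicial_convexHull_dehomogenize (hw : ∀ i, 0 < v i 0)
    (hgp : ∀ f : Fin (d + 1) → I, Function.Injective f → LinearIndependent ℝ (v ∘ f))
    (hcard : d + 1 ≤ Fintype.card I) :
    IsSimplicial (convexHull ℝ (range fun i => dehomogenize (v i))) := by
  classical
  intro F hF hne
  obtain ⟨l, M, hM, ⟨i₀, hi₀⟩, -, hFJ⟩ := hF.exists_functional
  set J : Finset I := Finset.univ.filter fun i => l (dehomogenize (v i)) = M with hJ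
  have hJset : {i | l (dehomogenize (v i)) = M} = (J : Set I) := by ext; simp [hJ]
  have hJcard : J.card ≤ d + 1 := by
    -- A functional that vanishes on `d + 1` independent vectors is zero, so the face would be the
    -- whole polytope.
    by_contra! hcon
    obtain ⟨K, hKJ, hK⟩ := Finset.exists_subset_card_eq hcon.le
    obtain ⟨g⟩ : Nonempty (Fin (d + 1) ≃ K) := ⟨(Fintype.equivFinOfCardEq (by simpa using hK)).symm⟩
    have hli := hgp (fun i => (g i : I)) (Subtype.val_injective.comp g.injective)
    obtain ⟨φ, hφ⟩ := exists_homogeneous_functional l M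
    have hφ0 : φ = 0 := by
      have hspan := hli.span_eq_top_of_card_eq_finrank' (by simp)
      refine LinearMap.ext_on_range (v := v ∘ fun i => (g i : I)) hspan fun i => ?_
      have := (Finset.mem_filter.1 (hKJ (g i).2)).2
      simp [hφ _ (hw _).ne', this]
    apply hne
    rw [hFJ]
    have : {i | l (dehomogenize (v i)) = M} = univ := by
      ext i
      have := hφ (v i) (hw i).ne'
      rw [hφ0, LinearMap.zero_apply] at this
      have := (mul_eq_zero.1 this.symm).resolve_left (hw i).ne'
      simp only [mem_ofPred_eq, mem_univ, iff_true]; linarith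
    rw [this, image_univ]
  -- General position speaks of exactly `d + 1` vectors, so `J` is enlarged and independence is then
  -- restricted back to it.
  obtain ⟨K, hJK, -, hK⟩ := Finset.exists_subsuperset_card_eq (Finset.subset_univ J) hJcard
    (by simpa using hcard)
  obtain ⟨g⟩ : Nonempty (Fin (d + 1) ≃ K) := ⟨(Fintype.equivFinOfCardEq (by simpa using hK)).symm⟩
  have hai := affineIndependent_dehomogenize hw
    (hgp (fun i => (g i : I)) (Subtype.val_injective.comp g.injective))
  obtain ⟨n, hn⟩ : ∃ n, J.card = n + 1 := Nat.exists_eq_succ_of_ne_zero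
    (Finset.card_pos.2 ⟨i₀, by simp [hJ, hi₀]⟩).ne'
  obtain ⟨h⟩ : Nonempty (Fin (n + 1) ≃ J) := ⟨(Fintype.equivFinOfCardEq (by simpa using hn)).symm⟩
  let emb : Fin (n + 1) ↪ Fin (d + 1) :=
    ⟨fun i => g.symm ⟨h i, hJK (h i).2⟩, fun a b hab => by simpa using hab⟩
  have hemb : ∀ i, (g (emb i) : I) = h i := fun i =>
    congrArg Subtype.val (g.apply_symm_apply ⟨(h i : I), hJK (h i).2⟩)
  refine ⟨n, ⟨_, hai.comp_embedding emb⟩, ?_⟩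
  rw [hFJ, hJset]
  congr 1
  ext x
  simp only [mem_image, mem_range, Function.comp, hemb]
  constructor
  · rintro ⟨i, hi, rfl⟩
    exact ⟨h.symm ⟨i, hi⟩, by simp⟩
  · rintro ⟨i, rfl⟩
    exact ⟨h i, (h i).2, rfl⟩

/-- The polytope of a vector configuration in general position. -/
theorem exists_polytope_of_generalPosition (hw : ∀ i, 0 < v i 0)
    (hgp : ∀ f : Fin (d + 1) → I, Function.Injective f → LinearIndependent ℝ (v ∘ f))
    (hv : ∀ p, ExposesPair v p p) {f : Fin (d + 1) → I} (hf : Function.Injective f) (hd : 2 ≤ d) :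
    ∃ P : Set (EuclideanSpace ℝ (Fin d)), IsPolytope P ∧ dim P = d ∧ IsSimplicial P ∧
      ∃ e : I ≃ Vertex P, (∀ p q, p ≠ q → ExposesPair v p q → (graph P).Adj (e p) (e q)) ∧
        ∀ p q, ObstructsPair v (range f) p q → ¬ (graph P).Adj (e p) (e q) := by
  classical
  have hinj := dehomogenize_injective hw hv
  refine ⟨convexHull ℝ (range fun i => dehomogenize (v i)),
    ⟨Finset.univ.image fun i => dehomogenize (v i), by simp⟩,
    dim_convexHull_dehomogenize hw (hgp f hf),
    isSimplicial_convexHull_dehomogenize hw hgp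
      (by simpa using Fintype.card_le_of_injective f hf), ?_⟩
  let e : I → Vertex (convexHull ℝ (range fun i => dehomogenize (v i))) :=
    fun i => ⟨dehomogenize (v i), (hv i).isFace_singleton hw⟩
  have he : Function.Bijective e := by
    refine ⟨fun i j hij => hinj (congrArg Subtype.val hij), fun ⟨x, hx⟩ => ?_⟩
    obtain ⟨l, M, -, ⟨i, hi⟩, -, hF⟩ := hx.exists_functional
    have : dehomogenize (v i) ∈ ({x} : Set (EuclideanSpace ℝ (Fin d))) := by
      rw [hF]; exact subset_convexHull ℝ _ ⟨i, hi, rfl⟩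
    exact ⟨i, Subtype.ext this⟩
  refine ⟨Equiv.ofBijective e he, fun p q hpq h => ⟨he.1.ne hpq, h.isFace hw⟩, fun p q h hadj => ?_⟩
  refine h.not_isFace hw hv ?_ hadj.2
  -- The basis has `d + 1 ≥ 3` members, so they cannot all be `p` or `q`.
  by_contra! hcon
  have hsub : Finset.univ.image f ⊆ {p, q} := by
    intro k hk
    obtain ⟨i, -, rfl⟩ := Finset.mem_image.1 hk
    by_cases hp : f i = p
    · simp [hp]
    · simp [hcon (f i) ⟨i, rfl⟩ hp]
  have h1 := Finset.card_le_card hsub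
  rw [Finset.card_image_of_injective _ hf, Finset.card_univ, Fintype.card_fin] at h1
  have := h1.trans Finset.card_le_two
  omega

end Homogeneous

/-! ### Perturbation into general position. -/

section Perturbation

/-- The determinant is a polynomial in `t` whose coefficient of degree `n` is the determinant of
`m`, hence it has finitely many roots. -/
lemma eventually_linearIndependent_add_smul {n : ℕ} (v m : Fin n → Fin n → ℝ)
    (hm : (Matrix.of m).det ≠ 0) :
    ∀ᶠ t : ℝ in 𝓝[≠] 0, LinearIndependent ℝ fun i => v i + t • m i := by
  set P : Polynomial ℝ := Matrix.det ((Polynomial.X : Polynomial ℝ) • (Matrix.of m).map Polynomial.C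
    + (Matrix.of v).map Polynomial.C) with hP
  have hP0 : P ≠ 0 := fun h => hm <| by
    have := Polynomial.coeff_det_X_add_C_card (Matrix.of m) (Matrix.of v)
    rw [← this, ← hP, h, Polynomial.coeff_zero]
  have hfin : ({t : ℝ | P.IsRoot t} \ {0}).Finite := (Polynomial.finite_setOfPred_isRoot hP0).sdiff
  have hmem : ({t : ℝ | P.IsRoot t} \ {0})ᶜ ∈ 𝓝 (0 : ℝ) :=
    hfin.isClosed.isOpen_compl.mem_nhds (by simp)
  filter_upwards [mem_nhdsWithin_of_mem_nhds hmem, self_mem_nhdsWithin] with t ht ht0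
  have hroot : ¬ P.IsRoot t := fun h => ht ⟨h, ht0⟩
  have hdet : (Matrix.of fun i => v i + t • m i).det = P.eval t := by
    rw [hP, ← Polynomial.coe_evalRingHom, RingHom.map_det]
    congr 1
    ext i j
    simp [add_comm, mul_comm t]
  exact Matrix.linearIndependent_rows_of_det_ne_zero (A := Matrix.of fun i => v i + t • m i)
    (by rw [hdet]; exact hroot)

variable {d : ℕ} {I : Type*} {v : I → Fin (d + 1) → ℝ}

lemma continuous_functional_add_smul (φ : (Fin (d + 1) → ℝ) →ₗ[ℝ] ℝ) (x m : Fin (d + 1) → ℝ) :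
    Continuous fun t : ℝ => φ (x + t • m) := by
  have := φ.continuous_of_finiteDimensional
  fun_prop

lemma ExposesPair.eventually [Finite I] {p q : I} (hpq : p ≠ q) (h : ExposesPair v p q)
    (hp : ExposesPair v p p) (hq : ExposesPair v q q) (m : I → Fin (d + 1) → ℝ) :
    ∀ᶠ t : ℝ in 𝓝 0, ExposesPair (fun i => v i + t • m i) p q := by
  obtain ⟨φ, hφp, hφq, hφ⟩ := h
  obtain ⟨b, hbp, -, hb⟩ := hp
  obtain ⟨a, haq, -, ha⟩ := hq
  have hap := ha p hpq hpq
  have hbq := hb q hpq.symm hpq.symm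
  -- The 3×3 determinant of `φ, a, b` evaluated at a variable vector and at the two perturbed
  -- vectors: it vanishes at both of them for every `t`, and at `t = 0` it is the positive multiple
  -- `a (v p) * b (v q)` of `φ`.
  let Φ : ℝ → (Fin (d + 1) → ℝ) →ₗ[ℝ] ℝ := fun t =>
    (a (v p + t • m p) * b (v q + t • m q) - b (v p + t • m p) * a (v q + t • m q)) • φ
    - (φ (v p + t • m p) * b (v q + t • m q) - φ (v q + t • m q) * b (v p + t • m p)) • a
    - (a (v p + t • m p) * φ (v q + t • m q) - a (v q + t • m q) * φ (v p + t • m p)) • b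
  have key : ∀ k, k ≠ p → k ≠ q → ∀ᶠ t : ℝ in 𝓝 0, 0 < Φ t (v k + t • m k) := fun k hkp hkq => by
    have hc : Continuous fun t : ℝ => Φ t (v k + t • m k) := by
      have h1 := continuous_functional_add_smul a (v p) (m p)
      have h2 := continuous_functional_add_smul a (v q) (m q)
      have h3 := continuous_functional_add_smul b (v p) (m p)
      have h4 := continuous_functional_add_smul b (v q) (m q)
      have h5 := continuous_functional_add_smul φ (v p) (m p)
      have h6 := continuous_functional_add_smul φ (v q) (m q)
      have h7 := continuous_functional_add_smul φ (v k) (m k)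
      have h8 := continuous_functional_add_smul a (v k) (m k)
      have h9 := continuous_functional_add_smul b (v k) (m k)
      simp only [Φ, LinearMap.sub_apply, LinearMap.smul_apply, smul_eq_mul]
      fun_prop
    refine (hc.tendsto 0).eventually (lt_mem_nhds ?_)
    have := mul_pos (mul_pos hap hbq) (hφ k hkp hkq)
    simpa [Φ, hφp, hφq, haq, hbp] using this
  have key' : ∀ᶠ t : ℝ in 𝓝 0, ∀ k, k ≠ p → k ≠ q → 0 < Φ t (v k + t • m k) := by
    simpa only [eventually_all, eventually_imp_distrib_left] using key
  filter_upwards [key'] with t ht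
  refine ⟨Φ t, ?_, ?_, ht⟩ <;>
  · simp only [Φ, LinearMap.sub_apply, LinearMap.smul_apply, smul_eq_mul]
    ring

lemma ObstructsPair.eventually [Fintype I] {p q : I} {f : Fin (d + 1) → I}
    (hinj : Function.Injective f) (hf : LinearIndependent ℝ (v ∘ f))
    (h : ObstructsPair v (range f) p q) (m : I → Fin (d + 1) → ℝ) :
    ∀ᶠ t : ℝ in 𝓝 0, ObstructsPair (fun i => v i + t • m i) (range f) p q := by
  classical
  obtain ⟨e, he, hnn, hpos⟩ := h
  let A : ℝ → Matrix (Fin (d + 1)) (Fin (d + 1)) ℝ :=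
    fun t => Matrix.of fun a i => v (f i) a + t * m (f i) a
  let r : Fin (d + 1) → ℝ := ∑ k, e k • m k
  -- Perturbing leaves the error `t • r` in the dependence. Cramer's rule expands it in the
  -- perturbed basis with coefficients tending to zero, and strict positivity on the basis absorbs
  -- their subtraction.
  let ρ : ℝ → Fin (d + 1) → ℝ := fun t => (A t).det⁻¹ • ((A t).adjugate.mulVec (t • r))
  have hA : Continuous A := by
    refine continuous_matrix fun a i => ?_
    simp only [A, Matrix.of_apply]
    fun_prop
  have hdet0 : (A 0).det ≠ 0 := by
    have : A 0 = (Matrix.of (v ∘ f)).transpose := by ext a i; simp [A]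
    rw [this, Matrix.det_transpose]
    have hu := Matrix.linearIndependent_rows_iff_isUnit (A := Matrix.of (v ∘ f)) |>.1 hf
    exact ((Matrix.isUnit_iff_isUnit_det _).1 hu).ne_zero
  have hρ0 : ρ 0 = 0 := by simp [ρ]
  have hρ : ContinuousAt ρ 0 := by
    refine ContinuousAt.smul (hA.matrix_det.continuousAt.inv₀ hdet0) ?_
    exact (hA.matrix_adjugate.matrix_mulVec (by fun_prop)).continuousAt
  have hdet : ∀ᶠ t in 𝓝 (0 : ℝ), (A t).det ≠ 0 :=
    hA.matrix_det.continuousAt.eventually_ne hdet0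
  have hsmall : ∀ᶠ t in 𝓝 (0 : ℝ), ∀ i, f i ≠ p → f i ≠ q → ρ t i < e (f i) := by
    have : ∀ i, f i ≠ p → f i ≠ q → ∀ᶠ t in 𝓝 (0 : ℝ), ρ t i < e (f i) := fun i hp hq => by
      have hc : ContinuousAt (fun t => ρ t i) 0 := (continuous_apply i).continuousAt.comp hρ
      refine hc.eventually (gt_mem_nhds ?_)
      simpa [hρ0] using hpos (f i) ⟨i, rfl⟩ hp hq
    simpa only [eventually_all, eventually_imp_distrib_left] using this
  filter_upwards [hdet, hsmall] with t hdt hst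
  refine ⟨fun k => e k - ∑ i, if f i = k then ρ t i else 0, ?_, fun k hkp hkq => ?_, ?_⟩
  · have h1 : ∑ k, e k • (v k + t • m k) = t • r := by
      simp only [smul_add, Finset.sum_add_distrib, he, zero_add, r, Finset.smul_sum]
      exact Finset.sum_congr rfl fun k _ => smul_comm _ _ _
    have h2 : ∑ k, (∑ i, if f i = k then ρ t i else 0) • (v k + t • m k) =
        ∑ i, ρ t i • (v (f i) + t • m (f i)) := by
      simp only [Finset.sum_smul, ite_smul, zero_smul]
      rw [Finset.sum_comm]
      simp
    have h3 : ∑ i, ρ t i • (v (f i) + t • m (f i)) = (A t).mulVec (ρ t) := by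
      ext a
      simp [Matrix.mulVec, dotProduct, A, add_mul, mul_comm (ρ t _)]
    have h4 : (A t).mulVec (ρ t) = t • r := by
      simp only [ρ, Matrix.mulVec_smul, Matrix.mulVec_mulVec, Matrix.mul_adjugate,
        Matrix.smul_mulVec, Matrix.one_mulVec]
      rw [smul_comm t, inv_smul_smul₀ hdt]
    simp only [sub_smul, Finset.sum_sub_distrib, h1, h2, h3, h4, sub_self]
  · by_cases hk : ∃ i, f i = k
    · obtain ⟨i, rfl⟩ := hk
      simpa [hinj.eq_iff] using (hst i hkp hkq).le
    · push Not at hk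
      simpa [hk] using hnn k hkp hkq
  · rintro _ ⟨i, rfl⟩ hp hq
    simpa [hinj.eq_iff] using hst i hp hq

/-- A vector configuration with prescribed exposed and obstructed pairs has a small perturbation
giving a simplicial polytope with the corresponding edges and non-edges. -/
theorem exists_simplicial_polytope [Fintype I] (hw : ∀ i, 0 < v i 0) {f : Fin (d + 1) → I}
    (hinj : Function.Injective f) (hf : LinearIndependent ℝ (v ∘ f)) (hd : 2 ≤ d)
    {R N : I → I → Prop} (hR : ∀ p q, R p q → p ≠ q ∧ ExposesPair v p q)
    (hdeg : ∀ p, ∃ q r, q ≠ r ∧ R p q ∧ R p r)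
    (hN : ∀ p q, N p q → ObstructsPair v (range f) p q) :
    ∃ P : Set (EuclideanSpace ℝ (Fin d)), IsPolytope P ∧ dim P = d ∧ IsSimplicial P ∧
      ∃ e : I ≃ Vertex P, (∀ p q, R p q → (graph P).Adj (e p) (e q)) ∧
        ∀ p q, N p q → ¬ (graph P).Adj (e p) (e q) := by
  let τ : I → ℝ := fun i => (Fintype.equivFin I i : ℕ)
  have hτ : Function.Injective τ := fun i j hij => by
    have : ((Fintype.equivFin I i : ℕ) : ℝ) = (Fintype.equivFin I j : ℕ) := hij
    exact (Fintype.equivFin I).injective (Fin.ext (by exact_mod_cast this))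
  -- Moving along the moment curve: any `d + 1` of these directions form a Vandermonde matrix with
  -- distinct nodes.
  let m : I → Fin (d + 1) → ℝ := fun i k => τ i ^ (k : ℕ)
  have hvert : ∀ p, ExposesPair v p p := fun p => by
    obtain ⟨q, r, hqr, hq, hr⟩ := hdeg p
    exact ExposesPair.vertex hqr (hR _ _ hq).2 (hR _ _ hr).2
  have h1 : ∀ᶠ t : ℝ in 𝓝 0, ∀ i, 0 < (v i + t • m i) 0 := by
    rw [eventually_all]
    intro i
    have hc : Continuous fun t : ℝ => (v i + t • m i) 0 := by
      simp only [Pi.add_apply, Pi.smul_apply, smul_eq_mul]; fun_prop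
    exact (hc.tendsto 0).eventually (lt_mem_nhds (by simpa using hw i))
  have h2 : ∀ᶠ t : ℝ in 𝓝 0, ∀ p q, R p q → ExposesPair (fun i => v i + t • m i) p q := by
    simp only [eventually_all]
    exact fun p q h => (hR p q h).2.eventually (hR p q h).1 (hvert p) (hvert q) m
  have h3 : ∀ᶠ t : ℝ in 𝓝 0, ∀ p q, N p q →
      ObstructsPair (fun i => v i + t • m i) (range f) p q := by
    simp only [eventually_all]
    exact fun p q h => (hN p q h).eventually hinj hf m
  have h4 : ∀ᶠ t : ℝ in 𝓝[≠] 0, ∀ g : Fin (d + 1) → I, Function.Injective g →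
      LinearIndependent ℝ ((fun i => v i + t • m i) ∘ g) := by
    simp only [eventually_all]
    intro g hg
    refine eventually_linearIndependent_add_smul (v ∘ g) (m ∘ g) ?_
    exact Matrix.det_vandermonde_ne_zero_iff.2 (hτ.comp hg)
  obtain ⟨t, ⟨⟨ht1, ht2⟩, ht3⟩, ht4⟩ := ((((h1.and h2).and h3).filter_mono nhdsWithin_le_nhds).and
    h4).exists
  obtain ⟨P, hP1, hP2, hP3, e, he1, he2⟩ := exists_polytope_of_generalPosition ht1 ht4
    (fun p => by
      obtain ⟨q, r, hqr, hq, hr⟩ := hdeg p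
      exact ExposesPair.vertex hqr (ht2 _ _ hq) (ht2 _ _ hr)) hinj hd
  exact ⟨P, hP1, hP2, hP3, e, fun p q h => he1 p q (hR p q h).1 (ht2 p q h),
    fun p q h => he2 p q (ht3 p q h)⟩

end Perturbation

/-! ### Counting the edges of cuts. -/

section Cuts

variable {W : Type*} {H : SimpleGraph W}

lemma cutEdges_compl (X : Set W) : cutEdges H Xᶜ = cutEdges H X := by
  ext e
  constructor <;> rintro ⟨he, u, hu, v, hv, rfl⟩
  · exact ⟨he, v, by simpa using hv, u, hu, Sym2.eq_swap⟩
  · exact ⟨he, v, hv, u, by simpa using hu, Sym2.eq_swap⟩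

lemma card_le_encard_cutEdges {X : Set W} {ι : Type*} [Fintype ι] (g : ι → W × W)
    (hg : Function.Injective g) (hX : ∀ i, (g i).1 ∈ X) (hXc : ∀ i, (g i).2 ∉ X)
    (hadj : ∀ i, H.Adj (g i).1 (g i).2) : (Fintype.card ι : ℕ∞) ≤ (cutEdges H X).encard := by
  have hinj : Function.Injective fun i => s((g i).1, (g i).2) := by
    intro i j hij
    rcases Sym2.eq_iff.1 hij with h | h
    · exact hg (Prod.ext h.1 h.2)
    · exact absurd (h.1 ▸ hX i) (hXc j)
  rw [← ENat.card_eq_coe_fintype_card, ← Set.encard_univ, ← hinj.encard_image]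
  refine Set.encard_le_encard ?_
  rintro _ ⟨i, -, rfl⟩
  exact ⟨hadj i, _, hX i, _, hXc i, rfl⟩

/-- Each clique vertex other than `K a` contributes its edge to `K b` or to `K a`, whichever lies on
the other side. -/
lemma le_encard_cutEdges_of_clique {X : Set W} {D : ℕ} {K : Fin (D + 1) → W}
    (hinj : Function.Injective K) (hK : ∀ s s', s ≠ s' → H.Adj (K s) (K s')) {a b : Fin (D + 1)}
    (ha : K a ∈ X) (hb : K b ∉ X) : (D : ℕ∞) ≤ (cutEdges H X).encard := by
  classical
  have hcard : Fintype.card {s // s ≠ a} = D := by simp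
  rw [← hcard]
  refine card_le_encard_cutEdges
    (fun s : {s // s ≠ a} => if K s ∈ X then (K s, K b) else (K a, K s)) ?_ ?_ ?_ ?_
  · intro s s' h
    apply Subtype.ext
    by_cases h1 : K s ∈ X <;> by_cases h2 : K s' ∈ X
    · simp only [h1, h2, if_true, Prod.mk.injEq, and_true] at h
      exact hinj h
    · simp only [h1, h2, if_true, if_false, Prod.mk.injEq] at h
      exact absurd (hinj h.1) s.2
    · simp only [h1, h2, if_true, if_false, Prod.mk.injEq] at h
      exact absurd (hinj h.1.symm) s'.2
    · simp only [h1, h2, if_false, Prod.mk.injEq, true_and] at h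
      exact hinj h
  · intro s
    by_cases h1 : K s ∈ X <;> simp [h1, ha]
  · intro s
    by_cases h1 : K s ∈ X <;> simp [h1, hb]
  · intro s
    by_cases h1 : K s ∈ X
    · simp only [h1, if_true]
      exact hK _ _ fun h => hb (h ▸ h1)
    · simp only [h1, if_false]
      exact hK _ _ s.2.symm

lemma le_encard_cutEdges_of_star {X : Set W} {n : ℕ} {K : Fin n → W}
    (hinj : Function.Injective K) {w : W} (hw : w ∉ X) (hK : ∀ s, K s ∈ X)
    (hadj : ∀ s, H.Adj w (K s)) : (n : ℕ∞) ≤ (cutEdges H X).encard := by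
  have := card_le_encard_cutEdges (H := H) (X := X) (fun s => (K s, w))
    (fun s s' h => hinj (Prod.mk.inj h).1) hK (fun _ => hw) (fun s => (hadj s).symm)
  simpa using this

lemma card_sorted_pairs (d : ℕ) :
    Fintype.card {p : Fin d × Fin d // p.1 ≤ p.2} = d * (d + 1) / 2 := by
  rw [← Fintype.card_congr (Sym2.sortEquiv (α := Fin d)), Sym2.card, Fintype.card_fin,
    Nat.choose_two_right, Nat.add_sub_cancel, mul_comm]

/-- Two cliques on `D + 1` vertices, each completely joined to `d` further vertices, with
`D = d (d + 1) / 2` edges between the two halves, have an edge cut as in the main theorem. -/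
theorem exists_nontrivial_minimumEdgeCut {d D : ℕ} (hD : D = d * (d + 1) / 2)
    (hDpos : 0 < D) (e : Bool × (Fin d ⊕ Fin (D + 1)) ≃ W)
    (hclique : ∀ b s s', s ≠ s' → H.Adj (e (b, .inr s)) (e (b, .inr s')))
    (hjoin : ∀ b i s, H.Adj (e (b, .inl i)) (e (b, .inr s)))
    (hcross : ∀ i j, i ≤ j → H.Adj (e (true, .inl i)) (e (false, .inl j)))
    (hcross' : ∀ x y, H.Adj (e (true, x)) (e (false, y)) → ∃ i j, i ≤ j ∧ x = .inl i ∧ y = .inl j) :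
    (∀ w, (D : ℕ∞) ≤ (H.neighborSet w).encard) ∧ ∃ C : Set (Sym2 W),
      IsMinimumEdgeCut H C ∧ ¬ IsTrivialCut H C ∧ C.encard = (D : ℕ∞) := by
  classical
  have hKinj : ∀ b, Function.Injective fun s => e (b, .inr s) := fun b s s' h => by
    simpa using e.injective h
  have hlower : ∀ X : Set W, X.Nonempty → Xᶜ.Nonempty → (D : ℕ∞) ≤ (cutEdges H X).encard := by
    intro X hX hXc
    by_contra hlt
    -- A cut with fewer than `D` edges keeps each half on one side.
    have huni : ∀ b, ∀ x, e (b, x) ∈ X ↔ e (b, .inr 0) ∈ X := by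
      have hS : ∀ b s s', e (b, .inr s) ∈ X → e (b, .inr s') ∈ X := by
        intro b s s' h
        by_contra h'
        exact hlt (le_encard_cutEdges_of_clique (hKinj b) (hclique b) h h')
      rintro b (i | s)
      · constructor
        · intro h
          by_contra h'
          refine hlt ?_
          rw [← cutEdges_compl]
          refine le_trans (by exact_mod_cast Nat.le_succ D)
            (le_encard_cutEdges_of_star (w := e (b, .inl i)) (hKinj b) (by simpa using h)
              (fun s hs => h' (hS b s 0 hs)) (hjoin b i))
        · intro h
          by_contra h'
          refine hlt ?_
          exact le_trans (by exact_mod_cast Nat.le_succ D)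
            (le_encard_cutEdges_of_star (w := e (b, .inl i)) (hKinj b) h'
              (fun s => hS b 0 s h) (hjoin b i))
      · exact ⟨hS b s 0, hS b 0 s⟩
    obtain ⟨x, hx⟩ := hX
    obtain ⟨y, hy⟩ := hXc
    obtain ⟨⟨b, x⟩, rfl⟩ := e.surjective x
    obtain ⟨⟨c, y⟩, rfl⟩ := e.surjective y
    rw [mem_compl_iff, huni] at hy
    rw [huni] at hx
    have key : ∀ Y : Set W, (∀ x, e (true, x) ∈ Y) → (∀ x, e (false, x) ∉ Y) →
        (D : ℕ∞) ≤ (cutEdges H Y).encard := by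
      intro Y h1 h2
      rw [hD, ← card_sorted_pairs d]
      refine card_le_encard_cutEdges (fun p : {p : Fin d × Fin d // p.1 ≤ p.2} =>
        (e (true, .inl p.1.1), e (false, .inl p.1.2))) ?_ (fun p => h1 _) (fun p => h2 _)
        (fun p => hcross _ _ p.2)
      intro p q h
      simp only [Prod.mk.injEq, EmbeddingLike.apply_eq_iff_eq, Sum.inl.injEq, true_and] at h
      exact Subtype.ext (Prod.ext h.1 h.2)
    rcases b with _ | _ <;> rcases c with _ | _
    · exact hy hx
    · refine hlt ?_
      rw [← cutEdges_compl]
      exact key _ (fun x => by rwa [mem_compl_iff, huni])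
        (fun x => by rwa [mem_compl_iff, not_not, huni])
    · exact hlt (key X (fun x => by rwa [huni]) (fun x => by rwa [huni]))
    · exact hy hx
  have hdegree : ∀ w, (D : ℕ∞) ≤ (H.neighborSet w).encard := by
    intro w
    obtain ⟨⟨b, i | s⟩, rfl⟩ := e.surjective w
    · calc (D : ℕ∞) ≤ ((D + 1 : ℕ) : ℕ∞) := by exact_mod_cast Nat.le_succ D
        _ = (range fun s : Fin (D + 1) => e (b, .inr s)).encard := by
          rw [← image_univ, (hKinj b).encard_image, encard_univ]; simp
        _ ≤ _ := encard_le_encard (by rintro _ ⟨s, rfl⟩; exact hjoin b i s)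
    · calc (D : ℕ∞) = ({s}ᶜ : Set (Fin (D + 1))).encard := by
            rw [← Finset.coe_singleton, ← Finset.coe_compl, encard_coe_eq_coe_finsetCard,
              Finset.card_compl]
            simp
        _ = ((fun s => e (b, .inr s)) '' ({s}ᶜ : Set (Fin (D + 1)))).encard :=
          ((hKinj b).encard_image _).symm
        _ ≤ _ := encard_le_encard (by rintro _ ⟨s', hs', rfl⟩; exact hclique b s s' (Ne.symm hs'))
  let X : Set W := {w | (e.symm w).1 = true}
  have hXne : X.Nonempty := ⟨e (true, .inr 0), by simp [X]⟩
  have hXcne : Xᶜ.Nonempty := ⟨e (false, .inr 0), by simp [X]⟩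
  have hcut : cutEdges H X = range fun p : {p : Fin d × Fin d // p.1 ≤ p.2} =>
      s(e (true, .inl p.1.1), e (false, .inl p.1.2)) := by
    ext c
    constructor
    · rintro ⟨hc, u, hu, v, hv, rfl⟩
      obtain ⟨⟨b, x⟩, rfl⟩ := e.surjective u
      obtain ⟨⟨b', y⟩, rfl⟩ := e.surjective v
      obtain rfl : b = true := by simpa [X] using hu
      obtain rfl : b' = false := by simpa [X] using hv
      obtain ⟨i, j, hij, rfl, rfl⟩ := hcross' x y hc
      exact ⟨⟨(i, j), hij⟩, rfl⟩
    · rintro ⟨p, rfl⟩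
      exact ⟨hcross _ _ p.2, _, by simp [X], _, by simp [X], rfl⟩
  have hcard : (cutEdges H X).encard = (D : ℕ∞) := by
    refine le_antisymm ?_ (hlower X hXne hXcne)
    rw [hcut, ← image_univ]
    refine (encard_image_le _ _).trans ?_
    rw [encard_univ, ENat.card_eq_coe_fintype_card, card_sorted_pairs, hD]
  refine ⟨hdegree, cutEdges H X, ⟨⟨X, hXne, hXcne, rfl⟩, ?_⟩, ?_, hcard⟩
  · rintro _ ⟨Y, hY, hYc, rfl⟩
    rw [hcard]
    exact hlower Y hY hYc
  · rintro ⟨w, hw⟩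
    -- Every vertex has a neighbour in its own half, while the cut contains only edges between the
    -- halves.
    have hmem : ∃ b x y, e (b, x) = w ∧ H.Adj (e (b, x)) (e (b, y)) := by
      obtain ⟨⟨b, i | s⟩, rfl⟩ := e.surjective w
      · exact ⟨b, _, .inr 0, rfl, hjoin b i 0⟩
      · have : Nontrivial (Fin (D + 1)) := Fin.nontrivial_iff_two_le.2 (by omega)
        obtain ⟨s', hs'⟩ := exists_ne s
        exact ⟨b, _, .inr s', rfl, hclique b s s' hs'.symm⟩
    obtain ⟨b, x, y, rfl, hadj⟩ := hmem
    have hin : s(e (b, x), e (b, y)) ∈ cutEdges H X := by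
      rw [hw]
      exact ⟨hadj, Sym2.mem_mk_left _ _⟩
    rw [hcut] at hin
    obtain ⟨p, hp⟩ := hin
    rcases Sym2.eq_iff.1 hp with ⟨h1, h2⟩ | ⟨h1, h2⟩ <;>
    · have h1 := congrArg Prod.fst (e.injective h1)
      have h2 := congrArg Prod.fst (e.injective h2)
      simp only at h1 h2
      rw [← h1] at h2
      exact absurd h2 (by decide)

end Cuts

/-! ### The quartic curve of the clusters and its positive weights. -/

section ClusterCurve

/-- The curve along which the clusters of vertices are placed, in coordinates with respect to the
vertices of the facet that they are close to. -/
def clusterCurve (n : ℕ) (s : ℝ) : Fin (n + 4) → ℝ :=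
  Fin.cons (s + s ^ 2) <| Fin.cons (-s + s ^ 2) <| Fin.cons (2 * s - s ^ 2 + s ^ 3) <|
    Fin.cons (-2 * s - s ^ 2 - s ^ 3 + s ^ 4) fun _ => 0

lemma forall_fin_add_four {n : ℕ} {P : Fin (n + 4) → Prop} :
    (∀ k, P k) ↔ P 0 ∧ P (Fin.succ 0) ∧ P (Fin.succ (Fin.succ 0)) ∧
      P (Fin.succ (Fin.succ (Fin.succ 0))) ∧
      ∀ k : Fin n, P (Fin.succ (Fin.succ (Fin.succ (Fin.succ k)))) := by
  simp only [Fin.forall_fin_succ (n := n + 3), Fin.forall_fin_succ (n := n + 2),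
    Fin.forall_fin_succ (n := n + 1), Fin.forall_fin_succ (n := n)]

lemma abs_clusterCurve_le {n : ℕ} {s : ℝ} (h0 : 0 ≤ s) (h1 : s ≤ 1 / 100) (k : Fin (n + 4)) :
    |clusterCurve n s k| ≤ 1 / 10 := by
  have h2 : s ^ 2 ≤ 1 / 100 * s := by nlinarith
  have h3 : s ^ 3 ≤ 1 / 100 * s ^ 2 := by nlinarith [sq_nonneg s]
  have h4 : s ^ 4 ≤ 1 / 100 * s ^ 3 := by nlinarith [pow_nonneg h0 3]
  have h2' := pow_nonneg h0 2
  have h3' := pow_nonneg h0 3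
  have h4' := pow_nonneg h0 4
  revert k
  rw [forall_fin_add_four]
  simp only [clusterCurve, Fin.cons_zero, Fin.cons_succ, abs_le]
  refine ⟨⟨?_, ?_⟩, ⟨?_, ?_⟩, ⟨?_, ?_⟩, ⟨?_, ?_⟩, fun _ => ⟨?_, ?_⟩⟩ <;> linarith

lemma sum_clusterCurve_sub_mul {n : ℕ} (s r a₀ a₁ a₂ a₃ : ℝ) (a : Fin n → ℝ) :
    ∑ k, (clusterCurve n r k - clusterCurve n s k) *
      (Fin.cons a₀ (Fin.cons a₁ (Fin.cons a₂ (Fin.cons a₃ a))) : Fin (n + 4) → ℝ) k =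
      (r + r ^ 2 - (s + s ^ 2)) * a₀ + (-r + r ^ 2 - (-s + s ^ 2)) * a₁ +
      (2 * r - r ^ 2 + r ^ 3 - (2 * s - s ^ 2 + s ^ 3)) * a₂ +
      (-2 * r - r ^ 2 - r ^ 3 + r ^ 4 - (-2 * s - s ^ 2 - s ^ 3 + s ^ 4)) * a₃ := by
  simp only [clusterCurve, Fin.sum_univ_succ, Fin.cons_zero, Fin.cons_succ, sub_self, zero_mul,
    Finset.sum_const_zero]
  ring

/-- The first four coordinates of the curve form a basis of the quartics without constant term,
chosen so that their sum is `s ^ 4`. The weights for `s = s' = 0` are thus all 1, and they stay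
positive for small parameters. Comparing coefficients gives the formulas. -/
lemma exists_weights_pair {n : ℕ} {s s' : ℝ} (h0 : 0 ≤ s) (h1 : s ≤ 1 / 100) (h0' : 0 ≤ s')
    (h1' : s' ≤ 1 / 100) (a : Fin n → ℝ) :
    ∃ a₀ a₁ a₂ a₃ : ℝ, 0 < a₀ ∧ 0 < a₁ ∧ 0 < a₂ ∧ 0 < a₃ ∧
      ∀ r, ∑ k, (clusterCurve n r k - clusterCurve n s k) *
        (Fin.cons a₀ (Fin.cons a₁ (Fin.cons a₂ (Fin.cons a₃ a))) : Fin (n + 4) → ℝ) k =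
        (r - s) ^ 2 * (r - s') ^ 2 := by
  have hss := mul_nonneg h0 h0'
  have hss' : s * s' ≤ 1 / 100 * s := by nlinarith
  refine ⟨1 + (s + s') + (s ^ 2 + 4 * s * s' + s' ^ 2) / 2 - s * s' * (s + s'),
    1 - 3 * (s + s') + (s ^ 2 + 4 * s * s' + s' ^ 2) / 2 + s * s' * (s + s'),
    1 - 2 * (s + s'), 1, ?_, ?_, ?_, one_pos, fun r => ?_⟩
  · nlinarith [sq_nonneg s, sq_nonneg s', mul_nonneg hss (by linarith : 0 ≤ 1 - (s + s'))]
  · nlinarith [sq_nonneg s, sq_nonneg s', mul_nonneg hss (add_nonneg h0 h0')]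
  · linarith
  · rw [sum_clusterCurve_sub_mul]; ring

lemma exists_weights_point {n : ℕ} {s : ℝ} (h0 : 0 ≤ s) (h1 : s ≤ 1 / 100) (i : Fin (n + 4)) :
    ∃ α : Fin (n + 4) → ℝ, α i = 0 ∧ (∀ k, k ≠ i → 0 < α k) ∧
      ∀ r, 0 ≤ r → r ≤ 1 / 100 → r ≠ s →
        0 < ∑ k, (clusterCurve n r k - clusterCurve n s k) * α k := by
  have h2 : s ^ 2 ≤ 1 / 100 * s := by nlinarith
  have h3 : s ^ 3 ≤ 1 / 100 * s ^ 2 := by nlinarith [sq_nonneg s]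
  have h4 : s ^ 4 ≤ 1 / 100 * s ^ 3 := by nlinarith [pow_nonneg h0 3]
  have h2' := pow_nonneg h0 2
  have h3' := pow_nonneg h0 3
  have h4' := pow_nonneg h0 4
  revert i
  rw [forall_fin_add_four]
  -- The linear coefficients 1, -1, 2, -2 retain both signs when one is dropped. So positive weights
  -- on the other three coordinates can make the derivative at `s` vanish, which leaves `(r - s) ^
  -- 2` times a positive factor.
  refine ⟨⟨Fin.cons 0 <| Fin.cons (5 * (2 - 2 * s + 3 * s ^ 2) -
      (2 + 2 * s + 3 * s ^ 2 - 4 * s ^ 3)) <| Fin.cons (5 * (1 - 2 * s)) <|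
      Fin.cons (1 - 2 * s) 1, ?_⟩,
    ⟨Fin.cons (10 * (2 + 2 * s + 3 * s ^ 2 - 4 * s ^ 3) - (2 - 2 * s + 3 * s ^ 2)) <|
      Fin.cons 0 <| Fin.cons (1 + 2 * s) <| Fin.cons (10 * (1 + 2 * s)) 1, ?_⟩,
    ⟨Fin.cons ((5 - 2 * s - 4 * s ^ 2 + 2 * s ^ 3) / 2) <|
      Fin.cons ((1 + 6 * s - 2 * s ^ 2 - 2 * s ^ 3) / 2) <|
      Fin.cons 0 <| Fin.cons 1 1, ?_⟩,
    ⟨Fin.cons ((1 - 6 * s + s ^ 2) / 2) <| Fin.cons ((5 + 2 * s - s ^ 2) / 2) <|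
      Fin.cons 1 <| Fin.cons 0 1, ?_⟩, fun j => ?_⟩
  · have hα : 0 < 1 - 2 * s := by linarith
    refine ⟨rfl, ?_, fun r hr0 hr1 hrs => ?_⟩
    · rw [forall_fin_add_four]
      simp only [Fin.cons_zero, Fin.cons_succ, Pi.one_apply, ne_eq, not_true_eq_false]
      refine ⟨fun h => h.elim, fun _ => ?_, fun _ => ?_, fun _ => hα, fun _ _ => one_pos⟩ <;>
      linarith
    · rw [sum_clusterCurve_sub_mul]
      have hq : 0 < (1 - 2 * s) * r ^ 2 + (1 - 2 * s) * (4 + 2 * s) * r +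
          (2 + 8 * s - s ^ 2 - 2 * s ^ 3) := by
        have : 0 ≤ (1 - 2 * s) * (4 + 2 * s) * r := by positivity
        have : 0 ≤ (1 - 2 * s) * r ^ 2 := by positivity
        linarith
      have := mul_pos (sq_pos_of_pos (abs_pos.2 (sub_ne_zero.2 hrs))) hq
      rw [sq_abs] at this
      linarith
  · have hα : 0 < 1 + 2 * s := by linarith
    refine ⟨rfl, ?_, fun r hr0 hr1 hrs => ?_⟩
    · rw [forall_fin_add_four]
      simp only [Fin.cons_zero, Fin.cons_succ, Pi.one_apply, ne_eq, not_true_eq_false]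
      refine ⟨fun _ => ?_, fun h => h.elim, fun _ => hα, fun _ => ?_, fun _ _ => one_pos⟩ <;>
      linarith
    · rw [sum_clusterCurve_sub_mul]
      have hq : 0 < (10 + 20 * s) * r ^ 2 + (1 + 2 * s) * (20 * s - 9) * r +
          (7 - 18 * s + 21 * s ^ 2 + 20 * s ^ 3) := by
        have : 0 ≤ (10 + 20 * s) * r ^ 2 := by positivity
        have : 0 ≤ s * r := by positivity
        have : 0 ≤ s ^ 2 * r := by positivity
        linarith
      have := mul_pos (sq_pos_of_pos (abs_pos.2 (sub_ne_zero.2 hrs))) hq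
      rw [sq_abs] at this
      linarith
  · refine ⟨rfl, ?_, fun r hr0 hr1 hrs => ?_⟩
    · rw [forall_fin_add_four]
      simp only [Fin.cons_zero, Fin.cons_succ, Pi.one_apply, ne_eq, not_true_eq_false]
      refine ⟨fun _ => ?_, fun _ => ?_, fun h => h.elim, fun _ => one_pos, fun _ _ => one_pos⟩ <;>
      linarith
    · rw [sum_clusterCurve_sub_mul]
      have := mul_pos (sq_pos_of_pos (abs_pos.2 (sub_ne_zero.2 hrs)))
        (by nlinarith : 0 < r ^ 2 + (2 * s - 1) * r + 2)
      rw [sq_abs] at this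
      linarith
  · refine ⟨rfl, ?_, fun r hr0 hr1 hrs => ?_⟩
    · rw [forall_fin_add_four]
      simp only [Fin.cons_zero, Fin.cons_succ, Pi.one_apply, ne_eq, not_true_eq_false]
      refine ⟨fun _ => ?_, fun _ => ?_, fun _ => one_pos, fun h => h.elim, fun _ _ => one_pos⟩ <;>
      linarith
    · rw [sum_clusterCurve_sub_mul]
      have := mul_pos (sq_pos_of_pos (abs_pos.2 (sub_ne_zero.2 hrs))) (by linarith : 0 < r + 2)
      rw [sq_abs] at this
      linarith
  -- The curve is zero in this coordinate, so its weight is free; taking `s' = s` gives `(r - s) ^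
  -- 4`.
  · obtain ⟨a₀, a₁, a₂, a₃, p₀, p₁, p₂, p₃, h⟩ :=
      exists_weights_pair h0 h1 h0 h1 fun k => if k = j then 0 else 1
    refine ⟨Fin.cons a₀ <| Fin.cons a₁ <| Fin.cons a₂ <| Fin.cons a₃ fun k => if k = j then 0 else 1,
      by simp, ?_, fun r _ _ hrs => ?_⟩
    rotate_left
    · rw [h]
      have := sub_ne_zero.2 hrs
      positivity
    · rw [forall_fin_add_four]
      simp only [Fin.cons_zero, Fin.cons_succ]
      refine ⟨fun _ => p₀, fun _ => p₁, fun _ => p₂, fun _ => p₃, fun k hk => ?_⟩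
      have : k ≠ j := fun h => hk (by rw [h])
      simp [this]

end ClusterCurve

/-! ### The two simplices with their clusters, and the supporting functionals. -/

section Configuration

variable {d : ℕ}

/-- The homogeneous vectors between the two simplices. -/
noncomputable def baseVec (k : Fin d) : Fin (d + 1) → ℝ := Pi.single k.succ 1 + Pi.single 0 1

/-- The direction separating the two simplices. -/
noncomputable def heightVec : Fin (d + 1) → ℝ := Pi.single 0 (1 / 2)

/-- The vertices of one of the two simplices, tilted by `t` and at height `g`. -/
noncomputable def facetVec (t : Fin d → ℝ) (g : Fin (d + 1) → ℝ) (k : Fin d) : Fin (d + 1) → ℝ :=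
  baseVec k + t k • ∑ j, baseVec j + g

/-- A vertex slightly beyond one of the two simplices. -/
noncomputable def clusterVec (t : Fin d → ℝ) (g : Fin (d + 1) → ℝ) (c : Fin d → ℝ) :
    Fin (d + 1) → ℝ :=
  ∑ k, (1 + c k) • facetVec t g k + (1 / 4 : ℝ) • g

lemma map_facetVec (φ : (Fin (d + 1) → ℝ) →ₗ[ℝ] ℝ) (t : Fin d → ℝ) (g : Fin (d + 1) → ℝ)
    (k : Fin d) : φ (facetVec t g k) = φ (baseVec k) + t k * ∑ j, φ (baseVec j) + φ g := by
  simp [facetVec]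

lemma map_clusterVec (φ : (Fin (d + 1) → ℝ) →ₗ[ℝ] ℝ) (t : Fin d → ℝ) (g : Fin (d + 1) → ℝ)
    (c : Fin d → ℝ) :
    φ (clusterVec t g c) = ∑ k, (1 + c k) * φ (facetVec t g k) + 1 / 4 * φ g := by
  simp [clusterVec]

/-- The values of a functional at the base vectors and at `g` can be prescribed. -/
def IsHeight (g : Fin (d + 1) → ℝ) : Prop :=
  ∀ (l : Fin d → ℝ) (γ : ℝ), ∃ φ : (Fin (d + 1) → ℝ) →ₗ[ℝ] ℝ,
    (∀ k, φ (baseVec k) = l k) ∧ φ g = γ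

lemma isHeight_heightVec : IsHeight (heightVec (d := d)) := by
  intro l γ
  refine ⟨∑ k, (l k - 2 * γ) • LinearMap.proj (Fin.succ k) + (2 * γ) • LinearMap.proj 0,
    fun k => ?_, ?_⟩
  · simp [baseVec, LinearMap.sum_apply, Pi.single_apply]
  · simp [heightVec, LinearMap.sum_apply]; ring

lemma IsHeight.neg {g : Fin (d + 1) → ℝ} (hg : IsHeight g) : IsHeight (-g) := fun l γ => by
  obtain ⟨φ, h1, h2⟩ := hg l (-γ)
  exact ⟨φ, h1, by simp [h2]⟩

lemma sum_facetVec {t : Fin d → ℝ} (ht : ∑ k, t k = 0) (g : Fin (d + 1) → ℝ) :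
    ∑ k, facetVec t g k = ∑ k, baseVec k + (d : ℝ) • g := by
  simp only [facetVec, Finset.sum_add_distrib, ← Finset.sum_smul, ht, zero_smul, add_zero,
    Finset.sum_const, Finset.card_univ, Fintype.card_fin]
  simp [Nat.cast_smul_eq_nsmul]

/-- Balanced tilts cancel in the sum over a simplex, so the total over the base vectors must be `∑ α
- d * γ`; this determines the value at each base vector. -/
lemma IsHeight.exists_facet_functional {g : Fin (d + 1) → ℝ} (hg : IsHeight g) {t : Fin d → ℝ}
    (ht : ∑ k, t k = 0) (α : Fin d → ℝ) (γ : ℝ) :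
    ∃ φ : (Fin (d + 1) → ℝ) →ₗ[ℝ] ℝ, (∀ k, φ (facetVec t g k) = α k) ∧ φ g = γ ∧
      ∀ k, φ (facetVec (-t) (-g) k) = α k - 2 * γ - 2 * t k * (∑ j, α j - d * γ) := by
  obtain ⟨φ, h1, h2⟩ := hg (fun k => α k - γ - t k * (∑ j, α j - d * γ)) γ
  have hsum : ∑ j, φ (baseVec j) = ∑ j, α j - d * γ := by
    simp only [h1, Finset.sum_sub_distrib, ← Finset.sum_mul, ht]
    simp
  refine ⟨φ, fun k => ?_, h2, fun k => ?_⟩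
  · rw [map_facetVec, hsum, h1, h2]; ring
  · rw [map_facetVec, hsum, h1, map_neg, h2, Pi.neg_apply]; ring

/-- The tilts are small and balanced. -/
structure IsTilt (t : Fin d → ℝ) : Prop where
  sum_eq : ∑ k, t k = 0
  abs_le : ∀ k, d * |t k| ≤ 1 / 10

lemma IsTilt.neg {t : Fin d → ℝ} (ht : IsTilt t) : IsTilt (-t) :=
  ⟨by simp [ht.sum_eq], by simpa using ht.abs_le⟩

lemma IsTilt.abs_le' {t : Fin d → ℝ} (ht : IsTilt t) (k : Fin d) : |t k| ≤ 1 / 10 := by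
  have h1 : (1 : ℝ) ≤ d := by exact_mod_cast Fin.pos k
  nlinarith [ht.abs_le k, abs_nonneg (t k)]

lemma cluster_pos {φ : (Fin (d + 1) → ℝ) →ₗ[ℝ] ℝ} {t : Fin d → ℝ} {g : Fin (d + 1) → ℝ}
    {c : Fin d → ℝ} (hc : ∀ k, |c k| ≤ 1 / 10) (hφ : ∀ k, 0 ≤ φ (facetVec t g k))
    (h : 0 < 9 / 10 * ∑ k, φ (facetVec t g k) + 1 / 4 * φ g) : 0 < φ (clusterVec t g c) := by
  rw [map_clusterVec]
  have : 9 / 10 * ∑ k, φ (facetVec t g k) ≤ ∑ k, (1 + c k) * φ (facetVec t g k) := by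
    rw [Finset.mul_sum]
    refine Finset.sum_le_sum fun k _ => mul_le_mul_of_nonneg_right ?_ (hφ k)
    linarith [(abs_le.1 (hc k)).1]
  linarith

/-- A functional supporting one end of the configuration: it has prescribed values at one of the
simplices, vanishes at one of the cluster vertices beyond it, and is positive at the other end. -/
lemma exists_end_functional {g : Fin (d + 1) → ℝ} (hg : IsHeight g) {t : Fin d → ℝ} (ht : IsTilt t)
    {α : Fin d → ℝ} (hα : ∀ k, 0 ≤ α k) (hαpos : 0 < ∑ k, α k) {c₀ : Fin d → ℝ}
    (hc₀ : ∀ k, |c₀ k| ≤ 1 / 10) :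
    ∃ φ : (Fin (d + 1) → ℝ) →ₗ[ℝ] ℝ, (∀ k, φ (facetVec t g k) = α k) ∧
      (∀ c, φ (clusterVec t g c) = ∑ k, (c k - c₀ k) * α k) ∧
      (∀ k, 0 < φ (facetVec (-t) (-g) k)) ∧
      ∀ c : Fin d → ℝ, (∀ k, |c k| ≤ 1 / 10) → 0 < φ (clusterVec (-t) (-g) c) := by
  -- The factor -4 cancels the `1 / 4` in `clusterVec`, so that `φ` vanishes at the cluster vertex
  -- of `c₀`.
  obtain ⟨φ, h1, h2, h3⟩ := hg.exists_facet_functional ht.sum_eq α (-4 * ∑ k, (1 + c₀ k) * α k)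
  set S := ∑ k, α k with hS
  set G := ∑ k, (1 + c₀ k) * α k with hG
  have hGS : 9 / 10 * S ≤ G := by
    rw [hG, hS, Finset.mul_sum]
    refine Finset.sum_le_sum fun k _ => mul_le_mul_of_nonneg_right ?_ (hα k)
    linarith [(abs_le.1 (hc₀ k)).1]
  -- The value is `α k + 8 * G` up to a tilt term of size at most `S / 5 + 4 / 5 * G`.
  have hpos : ∀ k, 0 < φ (facetVec (-t) (-g) k) := fun k => by
    rw [h3]
    have ha := abs_le.1 (ht.abs_le' k)
    have hb := ht.abs_le k
    rw [← abs_of_nonneg (Nat.cast_nonneg (α := ℝ) d), ← abs_mul] at hb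
    have hb := abs_le.1 hb
    nlinarith [hα k, mul_le_mul_of_nonneg_right ha.2 hαpos.le,
      mul_le_mul_of_nonneg_right hb.2 (by linarith : 0 ≤ G)]
  refine ⟨φ, h1, fun c => ?_, hpos, fun c hc => cluster_pos hc (fun k => (hpos k).le) ?_⟩
  · rw [map_clusterVec, h2]
    simp only [h1]
    have : ∑ k, (c k - c₀ k) * α k = ∑ k, (1 + c k) * α k - G := by
      rw [hG, ← Finset.sum_sub_distrib]
      exact Finset.sum_congr rfl fun k _ => by ring
    rw [this]; ring
  · have := Finset.sum_nonneg fun k (_ : k ∈ Finset.univ) => (hpos k).le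
    rw [map_neg, h2]
    linarith

/-- A functional supporting the edge between the two simplices at `i` and `j`. -/
lemma exists_cross_functional {g : Fin (d + 1) → ℝ} (hg : IsHeight g) {t : Fin d → ℝ}
    (ht : IsTilt t) (hd : 4 ≤ d) {i j : Fin d} (hij : i = j ∨ t i < t j) :
    ∃ φ : (Fin (d + 1) → ℝ) →ₗ[ℝ] ℝ, φ (facetVec t g i) = 0 ∧ φ (facetVec (-t) (-g) j) = 0 ∧
      (∀ k, k ≠ i → 0 < φ (facetVec t g k)) ∧ (∀ k, k ≠ j → 0 < φ (facetVec (-t) (-g) k)) ∧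
      (∀ c : Fin d → ℝ, (∀ k, |c k| ≤ 1 / 10) → 0 < φ (clusterVec t g c)) ∧
      ∀ c : Fin d → ℝ, (∀ k, |c k| ≤ 1 / 10) → 0 < φ (clusterVec (-t) (-g) c) := by
  have hd' : (4 : ℝ) ≤ d := by exact_mod_cast hd
  have hdpos : (0 : ℝ) < d := by linarith
  have hbd : ∀ k, -(1 / 10) ≤ d * t k ∧ d * t k ≤ 1 / 10 := fun k => by
    have hb := ht.abs_le k
    rwa [← abs_of_nonneg (Nat.cast_nonneg (α := ℝ) d), ← abs_mul, abs_le] at hb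
  -- With the total over the base vectors normalized to 1, the values at the two simplices are `φ
  -- (baseVec k) ± (t k - (t i + t j) / 2)`. The value `(t j - t i) / 2` at `i` and `j` gives the
  -- two required zeros, and `x` spreads the rest of the total evenly. Using the cardinality of `{i,
  -- j}` covers `i = j`.
  set x : ℝ := (1 - (t j - t i)) / (d - ({i, j} : Finset (Fin d)).card) with hx
  have hcard : (({i, j} : Finset (Fin d)).card : ℝ) ≤ 2 := by exact_mod_cast Finset.card_le_two
  have hden : 0 < (d : ℝ) - ({i, j} : Finset (Fin d)).card := by linarith
  have hxmul : x * (d - ({i, j} : Finset (Fin d)).card) = 1 - (t j - t i) := by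
    rw [hx]; field_simp
  have hτ : t j - t i ≤ 1 / 5 := by
    linarith [(abs_le.1 (ht.abs_le' i)).1, (abs_le.1 (ht.abs_le' j)).2]
  have hxpos : 0 < x := div_pos (by linarith) hden
  have hxd : 4 / 5 ≤ d * x := by
    have : 0 ≤ x * (({i, j} : Finset (Fin d)).card : ℝ) := by positivity
    nlinarith
  obtain ⟨φ, h1, h2⟩ := hg (fun k => if k ∈ ({i, j} : Finset (Fin d)) then (t j - t i) / 2 else x)
    (-(t i + t j) / 2)
  have hsum : ∑ k, φ (baseVec k) = 1 := by
    simp only [h1]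
    rw [Finset.sum_ite, Finset.sum_const, Finset.sum_const, Finset.filter_mem_eq_inter,
      Finset.univ_inter, nsmul_eq_mul, nsmul_eq_mul]
    have hc : ((Finset.univ.filter fun k => k ∉ ({i, j} : Finset (Fin d))).card : ℝ) =
        d - ({i, j} : Finset (Fin d)).card := by
      have := Finset.card_add_card_compl ({i, j} : Finset (Fin d))
      have h' : Finset.univ.filter (fun k => k ∉ ({i, j} : Finset (Fin d))) =
        ({i, j} : Finset (Fin d))ᶜ := by ext; simp
      rw [h', eq_sub_iff_add_eq']
      rw [Fintype.card_fin] at this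
      exact_mod_cast this
    rw [hc, mul_comm _ x, hxmul]
    rcases eq_or_ne i j with rfl | hne
    · simp
    · rw [Finset.card_pair hne]; push_cast; ring
  have hA : ∀ k, φ (facetVec t g k) =
      (if k ∈ ({i, j} : Finset (Fin d)) then (t j - t i) / 2 else x) + t k - (t i + t j) / 2 :=
    fun k => by rw [map_facetVec, hsum, h1, h2]; ring
  have hB : ∀ k, φ (facetVec (-t) (-g) k) =
      (if k ∈ ({i, j} : Finset (Fin d)) then (t j - t i) / 2 else x) - t k + (t i + t j) / 2 :=
    fun k => by rw [map_facetVec, hsum, h1, map_neg, h2, Pi.neg_apply]; ring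
  have hAi : φ (facetVec t g i) = 0 := by rw [hA]; simp; ring
  have hBj : φ (facetVec (-t) (-g) j) = 0 := by rw [hB]; simp; ring
  have hApos : ∀ k, k ≠ i → 0 < φ (facetVec t g k) := fun k hk => by
    rw [hA]
    by_cases hkj : k = j
    · subst hkj
      have := hij.resolve_left hk.symm
      simp; linarith
    · have : 0 < d * (x + t k - (t i + t j) / 2) := by
        nlinarith [hbd i, hbd j, hbd k]
      simpa [hk, hkj] using pos_of_mul_pos_right this hdpos.le
  have hBpos : ∀ k, k ≠ j → 0 < φ (facetVec (-t) (-g) k) := fun k hk => by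
    rw [hB]
    by_cases hki : k = i
    · subst hki
      have := hij.resolve_left hk
      simp; linarith
    · have : 0 < d * (x - t k + (t i + t j) / 2) := by
        nlinarith [hbd i, hbd j, hbd k]
      simpa [hk, hki] using pos_of_mul_pos_right this hdpos.le
  have hAnn : ∀ k, 0 ≤ φ (facetVec t g k) := fun k => by
    by_cases h : k = i
    · rw [h, hAi]
    · exact (hApos k h).le
  have hBnn : ∀ k, 0 ≤ φ (facetVec (-t) (-g) k) := fun k => by
    by_cases h : k = j
    · rw [h, hBj]
    · exact (hBpos k h).le
  have hi := abs_le.1 (ht.abs_le' i)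
  have hj := abs_le.1 (ht.abs_le' j)
  refine ⟨φ, hAi, hBj, hApos, hBpos, fun c hc => cluster_pos hc hAnn ?_,
    fun c hc => cluster_pos hc hBnn ?_⟩
  · rw [← map_sum, sum_facetVec ht.sum_eq, map_add, map_smul, map_sum, hsum, h2, smul_eq_mul]
    linarith [hbd i, hbd j, (hbd i).1, (hbd i).2, (hbd j).1, (hbd j).2]
  · rw [← map_sum, sum_facetVec ht.neg.sum_eq, map_add, map_smul, map_sum, hsum, map_neg, h2,
      smul_eq_mul]
    linarith [hbd i, hbd j, (hbd i).1, (hbd i).2, (hbd j).1, (hbd j).2]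

end Configuration

/-! ### Edges and non-edges of the configuration. -/

section DoubleEnd

variable {d m : ℕ}

/-- One end of the configuration: a simplex and a cluster of vertices beyond it. -/
noncomputable def endVec (t : Fin d → ℝ) (g : Fin (d + 1) → ℝ) (F : Fin m → Fin d → ℝ) :
    Fin d ⊕ Fin m → Fin (d + 1) → ℝ :=
  Sum.elim (facetVec t g) fun s => clusterVec t g (F s)

variable {v : Bool × (Fin d ⊕ Fin m) → Fin (d + 1) → ℝ} {b : Bool} {t : Fin d → ℝ}
  {g : Fin (d + 1) → ℝ} {F : Fin m → Fin d → ℝ}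

lemma forall_two_ends {P : Bool × (Fin d ⊕ Fin m) → Prop} (b : Bool)
    (h1 : ∀ k, P (b, .inl k)) (h2 : ∀ s, P (b, .inr s)) (h3 : ∀ k, P (!b, .inl k))
    (h4 : ∀ s, P (!b, .inr s)) : ∀ k, P k := by
  rintro ⟨b', k | s⟩ <;> rcases Bool.eq_or_eq_not b' b with rfl | rfl
  exacts [h1 k, h3 k, h2 s, h4 s]

lemma exposesPair_cluster (hv : ∀ x, v (b, x) = endVec t g F x)
    (hv' : ∀ x, v (!b, x) = endVec (-t) (-g) F x) (hg : IsHeight g) (ht : IsTilt t)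
    (hF : ∀ s k, |F s k| ≤ 1 / 10) (hd : 0 < d) {s s' : Fin m}
    {α : Fin d → ℝ} (hα : ∀ k, 0 < α k) (h0 : ∑ k, (F s' k - F s k) * α k = 0)
    (hpos : ∀ r, r ≠ s → r ≠ s' → 0 < ∑ k, (F r k - F s k) * α k) :
    ExposesPair v (b, .inr s) (b, .inr s') := by
  have : Nonempty (Fin d) := ⟨⟨0, hd⟩⟩
  obtain ⟨φ, h1, h2, h3, h4⟩ := exists_end_functional hg ht (fun k => (hα k).le)
    (Finset.sum_pos (fun k _ => hα k) Finset.univ_nonempty) (hF s)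
  refine ⟨φ, ?_, ?_, forall_two_ends b ?_ ?_ ?_ ?_⟩
  · simp [hv, endVec, h2]
  · simpa [hv, endVec, h2] using h0
  · simp [hv, endVec, h1, hα]
  · intro r hr hr'
    simpa [hv, endVec, h2] using hpos r (by simpa using hr) (by simpa using hr')
  · intro k _ _
    simpa [hv', endVec] using h3 k
  · intro r _ _
    simpa [hv', endVec] using h4 _ (hF r)

lemma exposesPair_facet_cluster (hv : ∀ x, v (b, x) = endVec t g F x)
    (hv' : ∀ x, v (!b, x) = endVec (-t) (-g) F x) (hg : IsHeight g) (ht : IsTilt t)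
    (hF : ∀ s k, |F s k| ≤ 1 / 10) (hd : 2 ≤ d) {i : Fin d} {s : Fin m}
    {α : Fin d → ℝ} (hi : α i = 0) (hα : ∀ k, k ≠ i → 0 < α k)
    (hpos : ∀ r, r ≠ s → 0 < ∑ k, (F r k - F s k) * α k) :
    ExposesPair v (b, .inl i) (b, .inr s) := by
  have hnn : ∀ k, 0 ≤ α k := fun k => by
    by_cases h : k = i
    · rw [h, hi]
    · exact (hα k h).le
  have : Nontrivial (Fin d) := Fin.nontrivial_iff_two_le.2 hd
  obtain ⟨j, hj⟩ := exists_ne i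
  obtain ⟨φ, h1, h2, h3, h4⟩ := exists_end_functional hg ht hnn
    (Finset.sum_pos' (fun k _ => hnn k) ⟨j, Finset.mem_univ j, hα j hj⟩) (hF s)
  refine ⟨φ, ?_, ?_, forall_two_ends b ?_ ?_ ?_ ?_⟩
  · simp [hv, endVec, h1, hi]
  · simp [hv, endVec, h2]
  · intro k hk _
    simpa [hv, endVec, h1] using hα k (by simpa using hk)
  · intro r _ hr
    simpa [hv, endVec, h2] using hpos r (by simpa using hr)
  · intro k _ _
    simpa [hv', endVec] using h3 k
  · intro r _ _
    simpa [hv', endVec] using h4 _ (hF r)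

lemma exposesPair_cross (hv : ∀ x, v (b, x) = endVec t g F x)
    (hv' : ∀ x, v (!b, x) = endVec (-t) (-g) F x) (hg : IsHeight g) (ht : IsTilt t)
    (hF : ∀ s k, |F s k| ≤ 1 / 10) (hd : 4 ≤ d) {i j : Fin d} (hij : i = j ∨ t i < t j) :
    ExposesPair v (b, .inl i) (!b, .inl j) := by
  obtain ⟨φ, h1, h2, h3, h4, h5, h6⟩ := exists_cross_functional hg ht hd hij
  refine ⟨φ, ?_, ?_, forall_two_ends b ?_ ?_ ?_ ?_⟩
  · simpa [hv, endVec] using h1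
  · simpa [hv', endVec] using h2
  · intro k hk _
    simpa [hv, endVec] using h3 k (by simpa using hk)
  · intro r _ _
    simpa [hv, endVec] using h5 _ (hF r)
  · intro k _ hk
    simpa [hv', endVec] using h4 k (by simpa using hk)
  · intro r _ _
    simpa [hv', endVec] using h6 _ (hF r)

lemma ObstructsPair.symm {I : Type*} [Fintype I] {v : I → Fin (d + 1) → ℝ} {B : Set I} {p q : I}
    (h : ObstructsPair v B p q) : ObstructsPair v B q p := by
  obtain ⟨e, h1, h2, h3⟩ := h
  exact ⟨e, h1, fun k hq hp => h2 k hp hq, fun k hk hq hp => h3 k hk hp hq⟩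

lemma obstructsPair_of_coefficients (hv : ∀ x, v (b, x) = endVec t g F x)
    (hv' : ∀ x, v (!b, x) = endVec (-t) (-g) F x) {B : Set (Bool × (Fin d ⊕ Fin m))}
    (hB : ∀ k ∈ B, ∃ b i, k = (b, Sum.inl i)) {p q : Bool × (Fin d ⊕ Fin m)}
    (α β : Fin d → ℝ) (κ μ : Fin m → ℝ)
    (hsum : ∑ k, α k • facetVec t g k + ∑ s, κ s • clusterVec t g (F s) +
      (∑ k, β k • facetVec (-t) (-g) k + ∑ s, μ s • clusterVec (-t) (-g) (F s)) = 0)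
    (hα : ∀ k, (b, .inl k) ≠ p → (b, .inl k) ≠ q → 0 < α k)
    (hβ : ∀ k, (!b, .inl k) ≠ p → (!b, .inl k) ≠ q → 0 < β k)
    (hκ : ∀ s, (b, .inr s) ≠ p → (b, .inr s) ≠ q → 0 ≤ κ s)
    (hμ : ∀ s, (!b, .inr s) ≠ p → (!b, .inr s) ≠ q → 0 ≤ μ s) : ObstructsPair v B p q := by
  let e : Bool × (Fin d ⊕ Fin m) → ℝ :=
    fun k => if k.1 = b then Sum.elim α κ k.2 else Sum.elim β μ k.2
  have he : ∀ x, e (b, x) = Sum.elim α κ x := fun x => by simp [e]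
  have he' : ∀ x, e (!b, x) = Sum.elim β μ x := fun x => by simp [e]
  have hbool : ∀ f : Bool → Fin (d + 1) → ℝ, ∑ b', f b' = f b + f (!b) := fun f => by
    cases b <;> simp [add_comm]
  refine ⟨e, ?_, forall_two_ends b ?_ ?_ ?_ ?_, ?_⟩
  · rw [Fintype.sum_prod_type, hbool]
    simpa [he, he', hv, hv', endVec] using hsum
  · intro k hp hq
    simpa [he] using (hα k hp hq).le
  · intro s hp hq
    simpa [he] using hκ s hp hq
  · intro k hp hq
    simpa [he'] using (hβ k hp hq).le
  · intro s hp hq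
    simpa [he'] using hμ s hp hq
  · intro k hk hp hq
    obtain ⟨b', i, rfl⟩ := hB k hk
    rcases Bool.eq_or_eq_not b' b with rfl | rfl
    · simpa [he] using hα i hp hq
    · simpa [he'] using hβ i hp hq

/-- With A and B the two simplices, A_i + B_j - A_j - B_i is `2 * (t i - t j)` times the sum of the
base vectors, and all A_k and B_k together sum to twice that sum. -/
lemma obstructsPair_facets (hv : ∀ x, v (b, x) = endVec t g F x)
    (hv' : ∀ x, v (!b, x) = endVec (-t) (-g) F x) {B : Set (Bool × (Fin d ⊕ Fin m))}
    (hB : ∀ k ∈ B, ∃ b i, k = (b, Sum.inl i)) (ht : IsTilt t) {i j : Fin d} (hij : t j < t i) :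
    ObstructsPair v B (b, .inl i) (!b, .inl j) := by
  have hne : i ≠ j := fun h => by simp [h] at hij
  refine obstructsPair_of_coefficients hv hv' hB
    (fun k => (t i - t j) + Pi.single (M := fun _ => ℝ) j 1 k - Pi.single (M := fun _ => ℝ) i 1 k)
    (fun k => (t i - t j) + Pi.single (M := fun _ => ℝ) i 1 k - Pi.single (M := fun _ => ℝ) j 1 k)
    0 0 ?_ ?_ ?_ (by simp) (by simp)
  · simp only [add_smul, sub_smul, Finset.sum_add_distrib, Finset.sum_sub_distrib,
      ← Finset.smul_sum, sum_facetVec ht.sum_eq, sum_facetVec ht.neg.sum_eq, Pi.single_apply,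
      ite_smul, one_smul, zero_smul, Finset.sum_ite_eq', Finset.mem_univ, if_true, Pi.zero_apply,
      Finset.sum_const_zero]
    simp only [facetVec, Pi.neg_apply]
    module
  · intro k hk _
    have hk : k ≠ i := by simpa using hk
    by_cases hkj : k = j
    · subst hkj; simp [hk]; linarith
    · simp [hk, hkj]; linarith
  · intro k _ hk
    have hk : k ≠ j := by simpa using hk
    by_cases hki : k = i
    · subst hki; simp [hk]; linarith
    · simp [hk, hki]; linarith

/-- The terms `g / 4` and `-g / 4` cancel, so the sum of the two cluster vertices is a positive
combination of the simplex vertices. -/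
lemma obstructsPair_clusters (hv : ∀ x, v (b, x) = endVec t g F x)
    (hv' : ∀ x, v (!b, x) = endVec (-t) (-g) F x) {B : Set (Bool × (Fin d ⊕ Fin m))}
    (hB : ∀ k ∈ B, ∃ b i, k = (b, Sum.inl i)) (hF : ∀ s k, |F s k| ≤ 1 / 10) (s s' : Fin m) :
    ObstructsPair v B (b, .inr s) (!b, .inr s') := by
  refine obstructsPair_of_coefficients hv hv' hB (fun k => 1 + F s k) (fun k => 1 + F s' k)
    (-Pi.single s 1) (-Pi.single s' 1) ?_ ?_ ?_ ?_ ?_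
  · simp only [Pi.neg_apply, Pi.single_apply, neg_smul, ite_smul, one_smul, zero_smul,
      Finset.sum_neg_distrib, Finset.sum_ite_eq', Finset.mem_univ, if_true, clusterVec]
    module
  · intro k _ _
    linarith [(abs_le.1 (hF s k)).1]
  · intro k _ _
    linarith [(abs_le.1 (hF s' k)).1]
  · intro r hr _
    have : r ≠ s := by simpa using hr
    simp [this]
  · intro r _ hr
    have : r ≠ s' := by simpa using hr
    simp [this]

lemma obstructsPair_cluster_facet (hv : ∀ x, v (b, x) = endVec t g F x)
    (hv' : ∀ x, v (!b, x) = endVec (-t) (-g) F x) {B : Set (Bool × (Fin d ⊕ Fin m))}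
    (hB : ∀ k ∈ B, ∃ b i, k = (b, Sum.inl i)) (ht : IsTilt t) (hF : ∀ s k, |F s k| ≤ 1 / 10)
    (s : Fin m) (j : Fin d) : ObstructsPair v B (b, .inr s) (!b, .inl j) := by
  have hd : (1 : ℝ) ≤ d := by exact_mod_cast Fin.pos j
  have hb := ht.abs_le j
  rw [← abs_of_nonneg (Nat.cast_nonneg (α := ℝ) d), ← abs_mul] at hb
  have hb := abs_le.1 hb
  have htj := abs_le.1 (ht.abs_le' j)
  -- The term `1 / (8 * d)` makes the coefficients on the far simplex positive away from `j`, at the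
  -- cost of `g / 4`. The coefficient of `g` is then `2 * c * (1 - d * t j) - 1 / 4 - 1 / 4`, which
  -- this `c` makes zero.
  obtain ⟨c, hc⟩ : ∃ c : ℝ, c = 1 / (4 * (1 - d * t j)) := ⟨_, rfl⟩
  have hden : 0 < 1 - d * t j := by linarith
  have hcpos : 0 < c := by rw [hc]; positivity
  have hcmul : c * (1 - d * t j) = 1 / 4 := by rw [hc]; field_simp
  have hcle : c ≤ 5 / 18 := by nlinarith
  have hε : 1 / (8 * d : ℝ) ≤ 1 / 8 := by
    apply one_div_le_one_div_of_le <;> linarith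
  refine obstructsPair_of_coefficients hv hv' hB
    (fun k => (1 + F s k) + (-(1 / (8 * d)) - 2 * c * t j) + c * Pi.single (M := fun _ => ℝ) j 1 k)
    (fun k => 1 / (8 * d) - c * Pi.single (M := fun _ => ℝ) j 1 k)
    (-Pi.single s 1) 0 ?_ ?_ ?_ ?_ (by simp)
  · simp only [add_smul _ (c * _), add_smul _ (-(1 / (8 * (d : ℝ))) - _),
      sub_smul (1 / (8 * (d : ℝ))) (c * _)]
    simp only [Finset.sum_add_distrib, Finset.sum_sub_distrib, ← Finset.smul_sum, sum_facetVec ht.sum_eq, sum_facetVec ht.neg.sum_eq,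
      Pi.single_apply, mul_ite, mul_one, mul_zero,
      ite_smul, one_smul, zero_smul, Finset.sum_ite_eq', Finset.mem_univ, if_true, Pi.zero_apply,
      Finset.sum_const_zero, Pi.neg_apply, clusterVec, neg_smul, Finset.sum_neg_distrib]
    have hg : (-(1 / (8 * (d : ℝ))) - 2 * c * t j) * d + c - 1 / (8 * d) * d + c - 1 / 4 = 0 := by
      have : 1 / (8 * (d : ℝ)) * d = 1 / 8 := by field_simp
      linarith
    have hg' := congrArg (fun x : ℝ => x • g) hg
    simp only [zero_smul] at hg'
    refine Eq.trans ?_ hg'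
    simp only [facetVec, Pi.neg_apply]
    module
  · intro k _ _
    have h1 : 0 ≤ c * Pi.single (M := fun _ => ℝ) j 1 k :=
      mul_nonneg hcpos.le (by rw [Pi.single_apply]; split_ifs <;> norm_num)
    have h2 : c * t j ≤ 1 / 10 := by nlinarith
    linarith [(abs_le.1 (hF s k)).1]
  · intro k _ hk
    have : k ≠ j := by simpa using hk
    simp only [Pi.single_apply, this, if_false, mul_zero, sub_zero]
    positivity
  · intro r hr _
    have : r ≠ s := by simpa using hr
    simp [this]

/-- The indices of a basis: one simplex and the vertex `k₀` of the other one. -/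
def basisIndex (k₀ : Fin d) : Fin (d + 1) → Bool × (Fin d ⊕ Fin m) :=
  Fin.cons (false, .inl k₀) fun k => (true, .inl k)

lemma basisIndex_injective (k₀ : Fin d) : Function.Injective (basisIndex (m := m) k₀) := by
  rw [basisIndex, Fin.cons_injective_iff]
  exact ⟨by simp, fun i j h => by simpa using h⟩

lemma exists_eq_inl_of_mem_range_basisIndex {k₀ : Fin d} :
    ∀ k ∈ range (basisIndex (m := m) k₀), ∃ b i, k = (b, Sum.inl i) := by
  rintro _ ⟨a, rfl⟩
  refine Fin.cases ⟨false, k₀, rfl⟩ (fun k => ⟨true, k, rfl⟩) a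

lemma linearIndependent_basisIndex (hv : ∀ x, v (true, x) = endVec t g F x)
    (hv' : ∀ x, v (false, x) = endVec (-t) (-g) F x) (hg : IsHeight g) (ht : IsTilt t)
    (k₀ : Fin d) : LinearIndependent ℝ (v ∘ basisIndex k₀) := by
  rw [Fintype.linearIndependent_iff]
  intro c hc
  have hsum : c 0 • facetVec (-t) (-g) k₀ + ∑ k : Fin d, c k.succ • facetVec t g k = 0 := by
    rw [← hc, Fin.sum_univ_succ]
    simp [basisIndex, hv, hv', endVec]
  have hb := ht.abs_le k₀
  rw [← abs_of_nonneg (Nat.cast_nonneg (α := ℝ) d), ← abs_mul] at hb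
  have hb := abs_le.1 hb
  have h0 : c 0 = 0 := by
    -- This functional kills one simplex and takes the nonzero value `-2 + 2 * d * t k₀` at the
    -- vertex of the other.
    obtain ⟨φ, h1, -, h3⟩ := hg.exists_facet_functional ht.sum_eq 0 1
    have := congrArg φ hsum
    simp only [map_add, map_smul, map_sum, h1, h3, Pi.zero_apply, Finset.sum_const_zero, smul_eq_mul,
      mul_zero, add_zero, map_zero] at this
    refine (mul_eq_zero.1 this).resolve_right fun h => ?_
    linarith
  refine Fin.cases h0 fun i => ?_
  obtain ⟨φ, h1, -, -⟩ := hg.exists_facet_functional ht.sum_eq (Pi.single i 1) 0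
  have := congrArg φ hsum
  simpa [h0, h1, Pi.single_apply] using this

lemma endVec_pos (ht : IsTilt t) (hd : 4 ≤ d) (hF : ∀ s k, |F s k| ≤ 1 / 10)
    (hg : |g 0| = 1 / 2) (x : Fin d ⊕ Fin m) : 0 < endVec t g F x 0 := by
  let φ : (Fin (d + 1) → ℝ) →ₗ[ℝ] ℝ := LinearMap.proj 0
  have hd' : (4 : ℝ) ≤ d := by exact_mod_cast hd
  have hbase : ∀ k : Fin d, φ (baseVec k) = 1 := fun k => by
    simp [φ, baseVec, (Fin.succ_ne_zero k).symm]
  have hg2 := abs_le.1 hg.le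
  have hA : ∀ k, 2 / 5 ≤ φ (facetVec t g k) := fun k => by
    rw [map_facetVec]
    have hb := ht.abs_le k
    rw [← abs_of_nonneg (Nat.cast_nonneg (α := ℝ) d), ← abs_mul] at hb
    have hb := abs_le.1 hb
    simp only [hbase, Finset.sum_const, Finset.card_univ, Fintype.card_fin, nsmul_eq_mul, mul_one]
    simp only [φ, LinearMap.proj_apply]
    linarith
  rcases x with k | s
  · exact lt_of_lt_of_le (by norm_num) (hA k)
  · refine cluster_pos (φ := φ) (hF s) (fun k => le_trans (by norm_num) (hA k)) ?_
    have : (d : ℝ) * (2 / 5) ≤ ∑ k, φ (facetVec t g k) := by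
      have := Finset.sum_le_sum fun k (_ : k ∈ Finset.univ) => hA k
      simpa using this
    have hφg : φ g = g 0 := rfl
    rw [hφg]
    linarith

/-- Balanced increasing tilts. -/
lemma exists_tilt (hd : 0 < d) : ∃ t : Fin d → ℝ, IsTilt t ∧ StrictMono t := by
  have hd' : (0 : ℝ) < d := by exact_mod_cast hd
  -- An arithmetic progression centred at zero, scaled to meet the bound of `IsTilt`.
  refine ⟨fun k => (2 * (k : ℕ) + 1 - d) / (10 * d ^ 2), ⟨?_, fun k => ?_⟩, fun i j hij => ?_⟩
  · rw [← Finset.sum_div, Fin.sum_univ_eq_sum_range (fun k => (2 * (k : ℝ) + 1 - d)) d]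
    have h : ∀ n : ℕ, ∑ k ∈ Finset.range n, (2 * (k : ℝ) + 1 - d) = n * n - n * d := fun n => by
      induction n with
      | zero => simp
      | succ n ih => rw [Finset.sum_range_succ, ih]; push_cast; ring
    rw [h, sub_self, zero_div]
  · have hk : ((k : ℕ) : ℝ) + 1 ≤ d := by exact_mod_cast k.2
    have hk0 : (0 : ℝ) ≤ (k : ℕ) := Nat.cast_nonneg _
    rw [abs_div, abs_of_pos (by positivity : (0 : ℝ) < 10 * d ^ 2), mul_div_assoc',
      div_le_div_iff₀ (by positivity) (by norm_num)]
    have : |2 * ((k : ℕ) : ℝ) + 1 - d| ≤ d := abs_le.2 ⟨by linarith, by linarith⟩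
    nlinarith
  · have : ((i : ℕ) : ℝ) < (j : ℕ) := by exact_mod_cast hij
    simp only
    gcongr

end DoubleEnd

end PolytopeGraph

/-! ### Assembly of the configuration. -/

theorem proposition3p8 (d : ℕ) (hd : 4 ≤ d) :
    ∃ P : Set (EuclideanSpace ℝ (Fin d)),
      PolytopeGraph.IsPolytope P ∧
      PolytopeGraph.dim P = d ∧
      PolytopeGraph.IsSimplicial P ∧
      (∀ v : PolytopeGraph.Vertex P,
        ((d * (d + 1) / 2 : ℕ) : ℕ∞) ≤ ((PolytopeGraph.graph P).neighborSet v).encard) ∧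
      ∃ C : Set (Sym2 (PolytopeGraph.Vertex P)),
        PolytopeGraph.IsMinimumEdgeCut (PolytopeGraph.graph P) C ∧
        ¬ PolytopeGraph.IsTrivialCut (PolytopeGraph.graph P) C ∧
        C.encard = ((d * (d + 1) / 2 : ℕ) : ℕ∞) := by
  open PolytopeGraph in
  obtain ⟨n, rfl⟩ : ∃ n, d = n + 4 := ⟨d - 4, by omega⟩
  obtain ⟨D, hD⟩ : ∃ D, D = (n + 4) * (n + 4 + 1) / 2 := ⟨_, rfl⟩
  have hDpos : 2 ≤ D := by
    rw [hD, Nat.le_div_iff_mul_le two_pos]; nlinarith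
  obtain ⟨t, ht, htmono⟩ := exists_tilt (d := n + 4) (by omega)
  -- Distinct curve parameters in the range `[0, 1 / 100]` where the weights are positive.
  let c : Fin (D + 1) → ℝ := fun s => (s : ℕ) / (100 * (D + 1))
  have hc0 : ∀ s, 0 ≤ c s := fun s => by positivity
  have hc1 : ∀ s, c s ≤ 1 / 100 := fun s => by
    have : ((s : ℕ) : ℝ) ≤ D + 1 := by exact_mod_cast s.2.le
    simp only [c]
    rw [div_le_div_iff₀ (by positivity) (by norm_num)]
    linarith
  have hcinj : ∀ s s', s ≠ s' → c s ≠ c s' := fun s s' hne h => hne <| by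
    have : ((s : ℕ) : ℝ) = (s' : ℕ) := by
      simp only [c] at h
      field_simp at h
      exact h
    exact Fin.ext (by exact_mod_cast this)
  let F : Fin (D + 1) → Fin (n + 4) → ℝ := fun s => clusterCurve n (c s)
  have hF : ∀ s k, |F s k| ≤ 1 / 10 := fun s k => abs_clusterCurve_le (hc0 s) (hc1 s) k
  let v : Bool × (Fin (n + 4) ⊕ Fin (D + 1)) → Fin (n + 4 + 1) → ℝ := fun p =>
    bif p.1 then endVec t heightVec F p.2 else endVec (-t) (-heightVec) F p.2
  -- Negating tilt and height swaps the two ends, so each certificate is needed from one end only.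
  have hends : ∀ b, ∃ t' g, IsTilt t' ∧ IsHeight g ∧ (∀ x, v (b, x) = endVec t' g F x) ∧
      ∀ x, v (!b, x) = endVec (-t') (-g) F x := by
    rintro (_ | _)
    · exact ⟨-t, -heightVec, ht.neg, isHeight_heightVec.neg, fun _ => rfl,
        fun _ => by simp [v]⟩
    · exact ⟨t, heightVec, ht, isHeight_heightVec, fun _ => rfl, fun _ => rfl⟩
  have hvt : ∀ x, v (true, x) = endVec t heightVec F x := fun _ => rfl
  have hvf : ∀ x, v (!true, x) = endVec (-t) (-heightVec) F x := fun _ => rfl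
  have hclique : ∀ b s s', s ≠ s' → ExposesPair v (b, .inr s) (b, .inr s') := by
    intro b s s' hne
    obtain ⟨t', g, ht', hg, h1, h2⟩ := hends b
    obtain ⟨a₀, a₁, a₂, a₃, p₀, p₁, p₂, p₃, h⟩ :=
      exists_weights_pair (hc0 s) (hc1 s) (hc0 s') (hc1 s') fun _ : Fin n => 1
    refine exposesPair_cluster h1 h2 hg ht' hF (by omega) (forall_fin_add_four.2
      ⟨p₀, p₁, p₂, p₃, fun _ => one_pos⟩) ((h _).trans (by ring)) fun r hr hr' => ?_
    refine (h (c r)).symm ▸ ?_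
    have := sub_ne_zero.2 (hcinj _ _ hr)
    have := sub_ne_zero.2 (hcinj _ _ hr')
    positivity
  have hjoin : ∀ b i s, ExposesPair v (b, .inl i) (b, .inr s) := by
    intro b i s
    obtain ⟨t', g, ht', hg, h1, h2⟩ := hends b
    obtain ⟨α, hi, hα, h⟩ := exists_weights_point (hc0 s) (hc1 s) i
    exact exposesPair_facet_cluster h1 h2 hg ht' hF (by omega) hi hα fun r hr =>
      h _ (hc0 r) (hc1 r) (hcinj _ _ hr)
  have hcross : ∀ i j, i ≤ j → ExposesPair v (true, .inl i) (false, .inl j) := fun i j hij =>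
    exposesPair_cross hvt hvf isHeight_heightVec ht hF (by omega)
      (hij.eq_or_lt.imp_right fun h => htmono h)
  have hobs : ∀ x y, (¬ ∃ i j, i ≤ j ∧ x = Sum.inl i ∧ y = Sum.inl j) →
      ObstructsPair v (Set.range (basisIndex 0)) (true, x) (false, y) := by
    have hB := exists_eq_inl_of_mem_range_basisIndex (m := D + 1) (k₀ := (0 : Fin (n + 4)))
    rintro (i | s) (j | s') h
    · exact obstructsPair_facets hvt hvf hB ht
        (htmono (not_le.1 fun hij => h ⟨i, j, hij, rfl, rfl⟩))
    · obtain ⟨t', g, ht', hg, h1, h2⟩ := hends false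
      exact (obstructsPair_cluster_facet h1 h2 hB ht' hF s' i).symm
    · exact obstructsPair_cluster_facet hvt hvf hB ht hF s j
    · exact obstructsPair_clusters hvt hvf hB hF s s'
  have hpos : ∀ p, 0 < v p 0 := by
    have hd4 : 4 ≤ n + 4 := by omega
    rintro ⟨_ | _, x⟩
    · exact endVec_pos ht.neg hd4 hF (by simp [heightVec]) x
    · exact endVec_pos ht hd4 hF (by simp [heightVec]) x
  have hnontriv : Nontrivial (Fin (D + 1)) := Fin.nontrivial_iff_two_le.2 (by omega)
  obtain ⟨P, hP1, hP2, hP3, e, he1, he2⟩ := exists_simplicial_polytope hpos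
    (basisIndex_injective 0) (linearIndependent_basisIndex hvt hvf isHeight_heightVec ht 0)
    (by omega) (R := fun p q => p ≠ q ∧ ExposesPair v p q)
    (N := ObstructsPair v (Set.range (basisIndex 0))) (fun p q h => h)
    (by
      rintro ⟨b, i | s⟩
      · obtain ⟨s, hs⟩ := exists_ne (0 : Fin (D + 1))
        exact ⟨(b, .inr s), (b, .inr 0), by simpa using hs, ⟨by simp, hjoin b i s⟩, by simp,
          hjoin b i 0⟩
      · obtain ⟨s₁, h₁, s₂, h₂, hne⟩ := Finset.one_lt_card.1
          (show 1 < (Finset.univ.erase s).card by simp; omega)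
        have h₁ := (Finset.ne_of_mem_erase h₁).symm
        have h₂ := (Finset.ne_of_mem_erase h₂).symm
        exact ⟨(b, .inr s₁), (b, .inr s₂), by simpa using hne,
          ⟨by simpa using h₁, hclique b s s₁ h₁⟩, by simpa using h₂, hclique b s s₂ h₂⟩)
    (fun p q h => h)
  subst hD
  obtain ⟨h1, h2⟩ := exists_nontrivial_minimumEdgeCut rfl (by omega) e
    (fun b s s' hne => he1 _ _ ⟨by simpa using hne, hclique b s s' hne⟩)
    (fun b i s => he1 _ _ ⟨by simp, hjoin b i s⟩)
    (fun i j hij => he1 _ _ ⟨by simp, hcross i j hij⟩)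
    (fun x y hadj => by
      by_contra h
      exact he2 _ _ (hobs x y h) hadj)
  exact ⟨P, hP1, hP2, hP3, h1, h2⟩
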